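/- Let $d$ be a natural number. For $t\in\mathbb R_+^d=(0,\infty)^d$ let $D_t(0)=\{z\in\mathbb C^d: |z_j|<t_j,\ j=1,\dots,d\}$. Let $\mathcal R^\infty(\mathbb C^d)$ be the set of all non-negative $\chi\in L^\infty(\mathbb C^d)$ for which there are $t_1,t_2\in\mathbb R_+^d$ with $t_1\le t_2$ (componentwise), a constant $c>0$ and a function $\chi_0$ such that $\chi$ is supported in $\overline{D_{t_2}(0)}$, $\chi(z)=\chi_0(|z_1|,\dots,|z_d|)$, and $\chi\ge c$ on $D_{t_1}(0)$ (all up to null sets). Write $\chi(x,\xi)=\chi(x+i\xi)$ for $x,\xi\in\mathbb R^d$. Let $h_\alpha(x)=\pi^{-d/4}(-1)^{|\alpha|}(2^{|\alpha|}\alpha!)^{-1/2}e^{|x|^2/2}\,\partial^\alpha e^{-|x|^2}$, $\alpha\in\mathbb N^d$, be the Hermite functions, and let $\mathcal H_{0,\flat_1}(\mathbb R^d)$ be the set of all $f\in L^2(\mathbb R^d)$ such that for every $r\in\mathbb R_+^d$ there is a constant $C$ with $|(f,h_\alpha)_{L^2}|\le C\,r^\alpha(\alpha!)^{-1/2}$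 for all $\alpha\in\mathbb N^d$. Let $\phi(x)=\pi^{-d/4}e^{-|x|^2/2}$, let $V_\phi h(x,\xi)=\int_{\mathbb R^d}h(y)\,\phi(y-x)\,e^{-i\langle y,\xi\rangle}\,dy$, and for bounded measurable compactly supported $F$ on $\mathbb R^{2d}$ let $V_\phi^*F\in\mathscr S'(\mathbb R^d)$ be the tempered distribution given by $(V_\phi h,F)_{L^2(\mathbb R^{2d})}=(h,V_\phi^*F)_{L^2(\mathbb R^d)}$ for all $h\in\mathscr S(\mathbb R^d)$. **Proposition.** Let $\chi\in\mathcal R^\infty(\mathbb C^d)$ and let $f\in\mathscr S'(\mathbb R^d)$. Then the following conditions are equivalent: 1. $f\in\mathcal H_{0,\flat_1}(\mathbb R^d)$; 2. $f=V_\phi^*F$ for some $F\in\mathscr E'(\mathbb R^{2d})\cap L^\infty(\mathbb R^{2d})$ (that is, $F$ is essentially bounded and vanishes almost everywhere outside some compact set) such that, for some entire function $F_0$ on $\mathbb C^d$, $$F(x,\xi)=F_0(x-i\xi)\,e^{-i\langle x,\xi\rangle}\,\chi(x,\xi)\quad\text{for almost every }(x,\xi)\in\mathbb R^{2d}.$$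 -/

import Mathlib

noncomputable section

/-- The Gaussian window `φ(x) = π^{-d/4} e^{-|x|²/2}` on `ℝ^d`. -/
def gaussWindow (d : ℕ) (x : EuclideanSpace ℝ (Fin d)) : ℝ :=
  Real.pi ^ (-(d : ℝ) / 4) * Real.exp (-‖x‖ ^ 2 / 2)

/-- The Hermite function
`h_α(x) = π^{-d/4} (-1)^{|α|} (2^{|α|} α!)^{-1/2} e^{|x|²/2} ∂^α (e^{-|x|²})`, where
`∂^α (e^{-|x|²})` is written as the product of the derivatives of `t ↦ e^{-t²}` of order `α_j`
at `x_j`. -/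
def hermiteFun {d : ℕ} (α : Fin d → ℕ) (x : EuclideanSpace ℝ (Fin d)) : ℝ :=
  Real.pi ^ (-(d : ℝ) / 4) * (-1) ^ (∑ j, α j) *
    (2 ^ (∑ j, α j) * ∏ j, ((α j).factorial : ℝ)) ^ (-(1 / 2 : ℝ)) *
    Real.exp (‖x‖ ^ 2 / 2) *
    ∏ j, iteratedDeriv (α j) (fun t : ℝ => Real.exp (-t ^ 2)) (x j)

/-- The Hermite coefficient `c_h(u, α) = (u, h_α)_{L²}`. -/
def hermiteCoeff {d : ℕ} (u : EuclideanSpace ℝ (Fin d) → ℂ) (α : Fin d → ℕ) : ℂ :=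
  ∫ x, u x * (hermiteFun α x : ℂ)

/-- The weight `ϑ_{r,♭_σ}(α) = r^α (α!)^{-1/(2σ)}`. -/
def thetaFlat {d : ℕ} (σ : ℝ) (r : Fin d → ℝ) (α : Fin d → ℕ) : ℝ :=
  (∏ j, r j ^ α j) * (∏ j, ((α j).factorial : ℝ)) ^ (-(1 / (2 * σ)))

/-- The Beurling type Pilipović space `H_{0,♭_σ}(ℝ^d)`, as a set of tempered distributions:
all `f ∈ L²(ℝ^d)` such that for every `r ∈ ℝ_+^d` one has `|c_h(f, α)| ≤ C ϑ_{r,♭_σ}(α)` for all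
`α`, with a constant `C` that does not depend on `α`. -/
def pilipovicBeurlingFlat (d : ℕ) (σ : ℝ) :
    Set (TemperedDistribution (EuclideanSpace ℝ (Fin d)) ℂ) :=
  {f | ∃ u : MeasureTheory.Lp ℂ 2 (MeasureTheory.volume : MeasureTheory.Measure
        (EuclideanSpace ℝ (Fin d))),
      f = MeasureTheory.Lp.toTemperedDistribution u ∧
      ∀ r : Fin d → ℝ, (∀ j, 0 < r j) →
        ∃ C : ℝ, ∀ α : Fin d → ℕ, ‖hermiteCoeff u α‖ ≤ C * thetaFlat σ r α}

/-- The short-time Fourier transform with window `φ`: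
`V_φ f(x, ξ) = ∫ f(y) φ(y - x) e^{-i⟨y, ξ⟩} dy` (the window is real-valued). -/
def stft {d : ℕ} (f : EuclideanSpace ℝ (Fin d) → ℂ)
    (p : EuclideanSpace ℝ (Fin d) × EuclideanSpace ℝ (Fin d)) : ℂ :=
  ∫ y, f y * (gaussWindow d (y - p.1) : ℂ) *
    Complex.exp (-(Complex.I * ((inner ℝ y p.2 : ℝ) : ℂ)))

theorem gaussWindow_continuous (d : ℕ) : Continuous (gaussWindow d) := by
  unfold gaussWindow
  fun_prop

theorem gaussWindow_nonneg (d : ℕ) (x : EuclideanSpace ℝ (Fin d)) : 0 ≤ gaussWindow d x := by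
  unfold gaussWindow
  positivity

theorem gaussWindow_integrable (d : ℕ) :
    MeasureTheory.Integrable (gaussWindow d) := by
  have h := GaussianFourier.integrable_cexp_neg_mul_sq_norm_add (V := EuclideanSpace ℝ (Fin d))
    (b := (1 / 2 : ℂ)) (by norm_num) 0 0
  have h2 := (h.norm).const_mul (Real.pi ^ (-(d : ℝ) / 4))
  refine h2.congr (Filter.Eventually.of_forall fun x => ?_)
  simp only [gaussWindow, Complex.norm_exp]
  congr 2
  have : (-(1 / 2 : ℂ) * (‖x‖ : ℂ) ^ 2 + 0 * ((inner ℝ 0 x : ℝ) : ℂ)) =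
      ((-‖x‖ ^ 2 / 2 : ℝ) : ℂ) := by
    push_cast; ring
  rw [this, Complex.ofReal_re]

theorem stft_integrand_norm {d : ℕ} (f : EuclideanSpace ℝ (Fin d) → ℂ)
    (p : EuclideanSpace ℝ (Fin d) × EuclideanSpace ℝ (Fin d)) (y : EuclideanSpace ℝ (Fin d)) :
    ‖f y * (gaussWindow d (y - p.1) : ℂ) *
      Complex.exp (-(Complex.I * ((inner ℝ y p.2 : ℝ) : ℂ)))‖ =
      ‖f y‖ * gaussWindow d (y - p.1) := by
  rw [norm_mul, norm_mul, Complex.norm_exp, Complex.norm_real,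
    Real.norm_of_nonneg (gaussWindow_nonneg d _)]
  simp

theorem stft_integrand_continuous {d : ℕ} {f : EuclideanSpace ℝ (Fin d) → ℂ} (hf : Continuous f) :
    Continuous fun q : (EuclideanSpace ℝ (Fin d) × EuclideanSpace ℝ (Fin d)) ×
        EuclideanSpace ℝ (Fin d) =>
      f q.2 * (gaussWindow d (q.2 - q.1.1) : ℂ) *
        Complex.exp (-(Complex.I * ((inner ℝ q.2 q.1.2 : ℝ) : ℂ))) := by
  have := gaussWindow_continuous d
  fun_prop

theorem stft_integrand_integrable {d : ℕ} {f : EuclideanSpace ℝ (Fin d) → ℂ} (hf : Continuous f)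
    {M : ℝ} (hM : ∀ y, ‖f y‖ ≤ M)
    (p : EuclideanSpace ℝ (Fin d) × EuclideanSpace ℝ (Fin d)) :
    MeasureTheory.Integrable fun y => f y * (gaussWindow d (y - p.1) : ℂ) *
      Complex.exp (-(Complex.I * ((inner ℝ y p.2 : ℝ) : ℂ))) := by
  refine (((gaussWindow_integrable d).comp_sub_right p.1).const_mul M).mono' ?_ ?_
  · exact ((stft_integrand_continuous hf).comp
      (Continuous.prodMk_right p)).aestronglyMeasurable
  · refine Filter.Eventually.of_forall fun y => ?_
    rw [stft_integrand_norm]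
    exact mul_le_mul_of_nonneg_right (hM y) (gaussWindow_nonneg d _)

theorem norm_stft_le {d : ℕ} {f : EuclideanSpace ℝ (Fin d) → ℂ}
    {M : ℝ} (hM : ∀ y, ‖f y‖ ≤ M)
    (p : EuclideanSpace ℝ (Fin d) × EuclideanSpace ℝ (Fin d)) :
    ‖stft f p‖ ≤ M * ∫ y, gaussWindow d y := by
  unfold stft
  refine (MeasureTheory.norm_integral_le_of_norm_le
    (((gaussWindow_integrable d).comp_sub_right p.1).const_mul M)
    (Filter.Eventually.of_forall fun y => ?_)).trans_eq ?_
  · rw [stft_integrand_norm]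
    exact mul_le_mul_of_nonneg_right (hM y) (gaussWindow_nonneg d _)
  · rw [MeasureTheory.integral_const_mul,
      MeasureTheory.integral_sub_right_eq_self (gaussWindow d) p.1]

theorem stft_stronglyMeasurable {d : ℕ} {f : EuclideanSpace ℝ (Fin d) → ℂ} (hf : Continuous f) :
    MeasureTheory.StronglyMeasurable (stft f) :=
  MeasureTheory.StronglyMeasurable.integral_prod_right'
    (stft_integrand_continuous hf).stronglyMeasurable

theorem stftAdjoint_integrable {d : ℕ}
    {F : EuclideanSpace ℝ (Fin d) × EuclideanSpace ℝ (Fin d) → ℂ}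
    (hF : MeasureTheory.Integrable F) (g : SchwartzMap (EuclideanSpace ℝ (Fin d)) ℂ) :
    MeasureTheory.Integrable fun p => F p * star (stft (fun y => star (g y)) p) := by
  have hg : Continuous fun y => star (g y) := g.continuous.star
  refine hF.mul_bdd (c := SchwartzMap.seminorm ℂ 0 0 g * ∫ y, gaussWindow d y)
    (continuous_star.comp_stronglyMeasurable (stft_stronglyMeasurable hg)).aestronglyMeasurable
    (Filter.Eventually.of_forall fun p => ?_)
  rw [norm_star]
  exact norm_stft_le (fun y => by rw [norm_star]; exact SchwartzMap.norm_le_seminorm ℂ g y) p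

theorem stft_star_add {d : ℕ} (g h : SchwartzMap (EuclideanSpace ℝ (Fin d)) ℂ)
    (p : EuclideanSpace ℝ (Fin d) × EuclideanSpace ℝ (Fin d)) :
    stft (fun y => star ((g + h) y)) p =
      stft (fun y => star (g y)) p + stft (fun y => star (h y)) p := by
  unfold stft
  rw [← MeasureTheory.integral_add
    (stft_integrand_integrable g.continuous.star
      (fun y => by rw [norm_star]; exact SchwartzMap.norm_le_seminorm ℂ g y) p)
    (stft_integrand_integrable h.continuous.star
      (fun y => by rw [norm_star]; exact SchwartzMap.norm_le_seminorm ℂ h y) p)]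
  congr 1
  funext y
  simp only [add_apply, star_add]
  ring

theorem stft_star_smul {d : ℕ} (a : ℂ) (g : SchwartzMap (EuclideanSpace ℝ (Fin d)) ℂ)
    (p : EuclideanSpace ℝ (Fin d) × EuclideanSpace ℝ (Fin d)) :
    stft (fun y => star ((a • g) y)) p = star a * stft (fun y => star (g y)) p := by
  unfold stft
  rw [← MeasureTheory.integral_const_mul]
  congr 1
  funext y
  simp only [smul_apply, smul_eq_mul, star_mul']
  ring

/-- For an integrable `F` on `ℝ^{2d}`, the continuous functional
`g ↦ ∬ F(x, ξ) conj(V_φ(conj g)(x, ξ)) dx dξ` on the Schwartz space. -/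
def stftAdjointCLM {d : ℕ}
    (F : EuclideanSpace ℝ (Fin d) × EuclideanSpace ℝ (Fin d) → ℂ)
    (hF : MeasureTheory.Integrable F) :
    SchwartzMap (EuclideanSpace ℝ (Fin d)) ℂ →L[ℂ] ℂ :=
  SchwartzMap.mkCLMtoNormedSpace
    (fun g => ∫ p, F p * star (stft (fun y => star (g y)) p))
    (fun g h => by
      rw [← MeasureTheory.integral_add (stftAdjoint_integrable hF g)
        (stftAdjoint_integrable hF h)]
      congr 1
      funext p
      rw [stft_star_add, star_add]
      ring)
    (fun a g => by
      rw [RingHom.id_apply, smul_eq_mul, ← MeasureTheory.integral_const_mul]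
      congr 1
      funext p
      rw [stft_star_smul, star_mul', star_star]
      ring)
    (by
      have hI : 0 ≤ ∫ y, gaussWindow d y :=
        MeasureTheory.integral_nonneg (gaussWindow_nonneg d)
      refine ⟨{(0, 0)}, (∫ p, ‖F p‖) * ∫ y, gaussWindow d y, by positivity, fun g => ?_⟩
      rw [Finset.sup_singleton]
      refine (MeasureTheory.norm_integral_le_of_norm_le
        (hF.norm.mul_const (SchwartzMap.seminorm ℂ 0 0 g * ∫ y, gaussWindow d y))
        (Filter.Eventually.of_forall fun p => ?_)).trans_eq ?_
      · rw [norm_mul, norm_star]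
        exact mul_le_mul_of_nonneg_left (norm_stft_le
          (fun y => by rw [norm_star]; exact SchwartzMap.norm_le_seminorm ℂ g y) p) (norm_nonneg _)
      · rw [MeasureTheory.integral_mul_const]
        simp only [schwartzSeminormFamily]
        ring)

open Classical in
/-- The adjoint `V_φ^*` of the short-time Fourier transform, on integrable functions `F` on
`ℝ^{2d}`: the tempered distribution with `(V_φ h, F)_{L²(ℝ^{2d})} = (h, V_φ^* F)_{L²(ℝ^d)}` for
every Schwartz function `h`. (Compactly supported bounded functions are integrable; the value `0`
for non-integrable `F` is a placeholder.) -/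
def stftAdjoint {d : ℕ}
    (F : EuclideanSpace ℝ (Fin d) × EuclideanSpace ℝ (Fin d) → ℂ) :
    TemperedDistribution (EuclideanSpace ℝ (Fin d)) ℂ :=
  if hF : MeasureTheory.Integrable F then
    ContinuousLinearMap.toPointwiseConvergenceCLM _ _ _ _ (stftAdjointCLM F hF)
  else 0

theorem stftAdjoint_apply {d : ℕ}
    {F : EuclideanSpace ℝ (Fin d) × EuclideanSpace ℝ (Fin d) → ℂ}
    (hF : MeasureTheory.Integrable F) (g : SchwartzMap (EuclideanSpace ℝ (Fin d)) ℂ) :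
    stftAdjoint F g = ∫ p, F p * star (stft (fun y => star (g y)) p) := by
  rw [stftAdjoint, dif_pos hF]
  rfl

/-- Membership in `L^∞ ∩ E'`: essentially bounded (and measurable), and vanishing almost
everywhere outside some compact set. -/
def IsBoundedCompactlySupported {X : Type*} [TopologicalSpace X] [MeasureTheory.MeasureSpace X]
    (F : X → ℂ) : Prop :=
  MeasureTheory.MemLp F ⊤ MeasureTheory.volume ∧
    ∃ K : Set X, IsCompact K ∧ ∀ᵐ p, p ∉ K → F p = 0

theorem IsBoundedCompactlySupported.integrable {d : ℕ}
    {F : EuclideanSpace ℝ (Fin d) × EuclideanSpace ℝ (Fin d) → ℂ}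
    (hF : IsBoundedCompactlySupported F) : MeasureTheory.Integrable F := by
  obtain ⟨h1, K, hK, h2⟩ := hF
  have h3 : MeasureTheory.IntegrableOn F K := by
    have : MeasureTheory.IsFiniteMeasure (MeasureTheory.volume.restrict K) :=
      ⟨by rw [MeasureTheory.Measure.restrict_apply_univ]; exact hK.measure_lt_top⟩
    exact (h1.restrict K).integrable le_top
  refine (h3.integrable_indicator hK.measurableSet).congr ?_
  filter_upwards [h2] with p hp
  by_cases h : p ∈ K
  · rw [Set.indicator_of_mem h]
  · rw [Set.indicator_of_notMem h, hp h]

/-- The class `R^∞_{t₁,t₂}(ℂ^d)` of non-negative bounded functions (up to null sets) with support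
in the closed polydisc of radii `t₂`, that depend only on `(|z_1|, …, |z_d|)`, and that are bounded
from below by a positive constant on the open polydisc of radii `t₁`. -/
structure IsRadialClassWith {d : ℕ} (t₁ t₂ : Fin d → ℝ) (χ : (Fin d → ℂ) → ℝ) : Prop where
  memLp_top : MeasureTheory.MemLp χ ⊤ MeasureTheory.volume
  nonneg : ∀ᵐ z, 0 ≤ χ z
  support : ∀ᵐ z : Fin d → ℂ, (¬ ∀ j, ‖z j‖ ≤ t₂ j) → χ z = 0
  radial : ∃ χ₀ : (Fin d → ℝ) → ℝ, ∀ᵐ z, χ z = χ₀ (fun j => ‖z j‖)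
  lower : ∃ c : ℝ, 0 < c ∧ ∀ᵐ z : Fin d → ℂ, (∀ j, ‖z j‖ < t₁ j) → c ≤ χ z

/-- The class `R^∞(ℂ^d)`, the union of the classes `R^∞_{t₁,t₂}(ℂ^d)` over all
`t₁ ≤ t₂` in `ℝ_+^d`. -/
def IsRadialClass {d : ℕ} (χ : (Fin d → ℂ) → ℝ) : Prop :=
  ∃ t₁ t₂ : Fin d → ℝ, (∀ j, 0 < t₁ j) ∧ (∀ j, t₁ j ≤ t₂ j) ∧ IsRadialClassWith t₁ t₂ χ

end

/-! Write `w = x + iξ`. The distribution `V_φ^* F` is the function obtained by superposing the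
time-frequency shifts of the Gaussian with weight `F`, so Fubini expresses its Hermite coefficients
as integrals of `F` against the transforms of the `h_α`. Those are explicit: up to the factor
`(2^{|α|} α!)^{-1/2}` they are `w^α` times a Gaussian (`integral_hermiteFun_mul_window`). For `F =
F₀(w̄) e^{-i⟨x,ξ⟩} χ` the exponents combine, and the rescaled coefficient is `a_α = ∫ K(w̄) e^{-Σ
w_j²/8} w^α dμ(w)`, with `K(z) = F₀(z) e^{Σ z_j²/8}` and `dμ = χ(w) e^{-|w|²/4} dw`, where `μ` is
finite, has bounded support and is invariant under the torus (`IsRadialClass.integral_eq_moment`).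
Membership in `H_{0,♭_1}` means that `a_α` decays faster than every geometric sequence
(`flat_bound_iff_superDecay`). The claim becomes: the sequences of such moments of entire `K` are
exactly the superexponentially decaying ones.

Moments decay (`superDecay_moments`): invariance permits averaging over `w ↦ z⁻¹w` with `|z| = 1`,
which turns `w̄` into `z w̄`. The integrand is then holomorphic in `z ≠ 0`, and the circle can be
enlarged until `|z⁻¹w|` is as small as desired, while `K` stays bounded independently of `α`.

Every decaying sequence occurs (`exists_entire_gaussian_moments`): without the Gaussian factor,
monomials are orthogonal for `μ` and their square norms are bounded below geometrically, so `Σ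
(a_α/m_α) z^α` is entire with moments `a_α`. To insert a factor `e^{sQ}`, `Q = Σ w_j²`, take `k`
with moments `a`, then `G` with the moments of `k(w̄) e^{-sQ}`, which decay by the first half. The
two agree against polynomials in `w`, hence against `e^{sQ} w^α`, and the exponentials cancel.

Finally, completeness of the Hermite system (`ae_eq_zero_of_hermiteCoeff`) recovers `f` from its
coefficients. -/

noncomputable section

/-! ### Derivatives of the one-dimensional Gaussian -/

/-- The `n`-th derivative of `t ↦ e^{-t²}`. -/
def gaussDeriv (n : ℕ) (t : ℝ) : ℝ := iteratedDeriv n (fun t : ℝ => Real.exp (-t ^ 2)) t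

theorem gaussDeriv_zero (t : ℝ) : gaussDeriv 0 t = Real.exp (-t ^ 2) := by
  simp [gaussDeriv]

theorem hasDerivAt_gaussDeriv (n : ℕ) (t : ℝ) :
    HasDerivAt (gaussDeriv n) (gaussDeriv (n + 1) t) t := by
  have h : ContDiff ℝ ⊤ (fun t : ℝ => Real.exp (-t ^ 2)) := by fun_prop
  have h2 : Differentiable ℝ (gaussDeriv n) :=
    h.differentiable_iteratedDeriv n (by exact WithTop.coe_lt_top _)
  have h3 := (h2 t).hasDerivAt
  rwa [show deriv (gaussDeriv n) t = gaussDeriv (n + 1) t from by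
    simp only [gaussDeriv, iteratedDeriv_succ]; rfl] at h3

theorem continuous_gaussDeriv (n : ℕ) : Continuous (gaussDeriv n) :=
  continuous_iff_continuousAt.2 fun t => (hasDerivAt_gaussDeriv n t).continuousAt

theorem gaussDeriv_one (t : ℝ) : gaussDeriv 1 t = -2 * t * gaussDeriv 0 t := by
  have h : HasDerivAt (gaussDeriv 0) (Real.exp (-t ^ 2) * (-(2 * t))) t := by
    have h1 : HasDerivAt (fun t : ℝ => Real.exp (-t ^ 2)) (Real.exp (-t ^ 2) * (-(2 * t))) t := by
      have := ((hasDerivAt_pow 2 t).neg).exp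
      simpa using this
    rwa [show gaussDeriv 0 = fun t : ℝ => Real.exp (-t ^ 2) from funext gaussDeriv_zero]
  rw [(hasDerivAt_gaussDeriv 0 t).unique h, gaussDeriv_zero]
  ring

theorem gaussDeriv_add_two (n : ℕ) (t : ℝ) :
    gaussDeriv (n + 2) t = -2 * t * gaussDeriv (n + 1) t - 2 * (n + 1) * gaussDeriv n t := by
  induction n generalizing t with
  | zero =>
    have h : HasDerivAt (gaussDeriv 1) (-2 * t * gaussDeriv 1 t - 2 * gaussDeriv 0 t) t := by
      rw [show gaussDeriv 1 = fun t => -2 * t * gaussDeriv 0 t from funext gaussDeriv_one]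
      refine (((hasDerivAt_id' t).const_mul (-2)).mul
        (hasDerivAt_gaussDeriv 0 t)).congr_deriv ?_
      simp only [zero_add, gaussDeriv_one]
      ring
    rw [(hasDerivAt_gaussDeriv 1 t).unique h]
    simp
  | succ n ih =>
    have h : HasDerivAt (gaussDeriv (n + 2)) (-2 * t * gaussDeriv (n + 2) t
        - 2 * (n + 1 + 1) * gaussDeriv (n + 1) t) t := by
      rw [show gaussDeriv (n + 2) = fun t => -2 * t * gaussDeriv (n + 1) t
        - 2 * (n + 1) * gaussDeriv n t from funext ih]
      refine ((((hasDerivAt_id' t).const_mul (-2)).mul (hasDerivAt_gaussDeriv (n + 1) t)).sub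
        ((hasDerivAt_gaussDeriv n t).const_mul (2 * ((n : ℝ) + 1)))).congr_deriv ?_
      simp only [ih]
      ring
    rw [(hasDerivAt_gaussDeriv (n + 2) t).unique h]
    push_cast
    ring

/-- The three term recurrence, in a form valid for all `n`. -/
theorem mul_gaussDeriv (n : ℕ) (t : ℝ) :
    t * gaussDeriv n t = -(1 / 2) * gaussDeriv (n + 1) t - n * gaussDeriv (n - 1) t := by
  -- For `n = 0` the truncated index `n - 1` is harmless, since its coefficient vanishes.
  cases n with
  | zero => rw [zero_add, gaussDeriv_one]; push_cast; ring
  | succ n => rw [gaussDeriv_add_two, Nat.add_sub_cancel]; push_cast; ring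

/-- A linear factor costs an arbitrarily small part of the Gaussian rate: `|t|` is at most a
constant times `(b - a)t² + 1 ≤ e^{(b-a)t²}`. -/
theorem abs_mul_exp_neg_sq_le {a b : ℝ} (hab : a < b) :
    ∃ C : ℝ, 0 ≤ C ∧ ∀ t : ℝ, |t| * Real.exp (-b * t ^ 2) ≤ C * Real.exp (-a * t ^ 2) := by
  have hd : 0 < b - a := sub_pos.2 hab
  refine ⟨1 / (b - a) + 1, by positivity, fun t => ?_⟩
  have h1 : |t| ≤ (1 / (b - a) + 1) * ((b - a) * t ^ 2 + 1) := by
    have h2 : (1 / (b - a) + 1) * ((b - a) * t ^ 2 + 1)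
        = t ^ 2 + (b - a) * t ^ 2 + 1 / (b - a) + 1 := by field_simp; ring
    have h3 : |t| ≤ t ^ 2 + 1 := by
      rw [← sq_abs]; nlinarith [sq_nonneg (|t| - 1), abs_nonneg t]
    have : 0 < 1 / (b - a) := by positivity
    have : 0 ≤ (b - a) * t ^ 2 := by positivity
    linarith
  calc |t| * Real.exp (-b * t ^ 2)
      ≤ (1 / (b - a) + 1) * Real.exp ((b - a) * t ^ 2) * Real.exp (-b * t ^ 2) := by
        gcongr
        exact h1.trans (by gcongr; exact Real.add_one_le_exp _)
    _ = _ := by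
        rw [mul_assoc, ← Real.exp_add]
        congr 2
        ring

/-- The derivatives are polynomials times `e^{-t²}`, so every rate below `1` survives. The rate is
quantified inside the induction because each factor `t` in the recurrence lowers it slightly. -/
theorem abs_gaussDeriv_le (n : ℕ) : ∀ a < (1 : ℝ),
    ∃ C : ℝ, 0 ≤ C ∧ ∀ t, |gaussDeriv n t| ≤ C * Real.exp (-a * t ^ 2) := by
  induction n using Nat.strong_induction_on with
  | _ n ih =>
    intro a ha
    match n with
    | 0 =>
      refine ⟨1, zero_le_one, fun t => ?_⟩
      rw [gaussDeriv_zero, abs_of_pos (Real.exp_pos _), one_mul]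
      gcongr
      nlinarith [sq_nonneg t]
    | 1 =>
      obtain ⟨C, hC, h⟩ := abs_mul_exp_neg_sq_le ha
      refine ⟨2 * C, by positivity, fun t => ?_⟩
      have := h t
      rw [gaussDeriv_one, gaussDeriv_zero, abs_mul, abs_mul, abs_of_pos (Real.exp_pos _)]
      norm_num at this ⊢
      linarith
    | n + 2 =>
      obtain ⟨b, hab, hb⟩ := exists_between ha
      obtain ⟨C, hC, h⟩ := abs_mul_exp_neg_sq_le hab
      obtain ⟨C₁, hC₁, h₁⟩ := ih (n + 1) (by omega) b hb
      obtain ⟨C₀, hC₀, h₀⟩ := ih n (by omega) a ha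
      refine ⟨2 * C₁ * C + 2 * (n + 1) * C₀, by positivity, fun t => ?_⟩
      rw [gaussDeriv_add_two]
      calc |-2 * t * gaussDeriv (n + 1) t - 2 * (n + 1) * gaussDeriv n t|
          ≤ |-2 * t * gaussDeriv (n + 1) t| + |2 * (n + 1) * gaussDeriv n t| := abs_sub _ _
        _ = 2 * |t| * |gaussDeriv (n + 1) t| + 2 * (n + 1) * |gaussDeriv n t| := by
            simp only [abs_mul, abs_neg, Nat.abs_ofNat]
            rw [abs_of_pos (by positivity : (0 : ℝ) < (n : ℝ) + 1)]
        _ ≤ 2 * |t| * (C₁ * Real.exp (-b * t ^ 2))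
            + 2 * (n + 1) * (C₀ * Real.exp (-a * t ^ 2)) := by
            gcongr
            · exact h₁ t
            · exact h₀ t
        _ = 2 * C₁ * (|t| * Real.exp (-b * t ^ 2))
            + 2 * (n + 1) * (C₀ * Real.exp (-a * t ^ 2)) := by ring
        _ ≤ 2 * C₁ * (C * Real.exp (-a * t ^ 2))
            + 2 * (n + 1) * (C₀ * Real.exp (-a * t ^ 2)) := by
            have := mul_le_mul_of_nonneg_left (h t) (by positivity : 0 ≤ 2 * C₁)
            linarith
        _ = _ := by ring

theorem integrable_gaussDeriv_mul_cexp (n : ℕ) (w : ℂ) :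
    MeasureTheory.Integrable fun t : ℝ => (gaussDeriv n t : ℂ) * Complex.exp (t * w) := by
  obtain ⟨C, hC, h⟩ := abs_gaussDeriv_le n (1 / 2) (by norm_num)
  have h1 := (integrable_cexp_quadratic (b := 1 / 2) (by norm_num) w 0).norm.const_mul C
  refine h1.mono' ?_ (Filter.Eventually.of_forall fun t => ?_)
  · have := continuous_gaussDeriv n
    exact Continuous.aestronglyMeasurable (by fun_prop)
  · rw [norm_mul, Complex.norm_real, Real.norm_eq_abs, Complex.norm_exp, Complex.norm_exp]
    calc |gaussDeriv n t| * Real.exp ((t : ℂ) * w).re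
        ≤ C * Real.exp (-(1 / 2) * t ^ 2) * Real.exp ((t : ℂ) * w).re := by
          gcongr
          exact h t
      _ = _ := by
          rw [mul_assoc, ← Real.exp_add]
          congr 2
          simp [← Complex.ofReal_pow]
          ring

/-- Each integration by parts moves one derivative onto `e^{tw}` and contributes `-w`; what remains
is a Gaussian integral. -/
theorem integral_gaussDeriv_mul_cexp (n : ℕ) (w : ℂ) :
    ∫ t : ℝ, (gaussDeriv n t : ℂ) * Complex.exp (t * w) =
      (-w) ^ n * (Real.sqrt Real.pi * Complex.exp (w ^ 2 / 4)) := by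
  induction n with
  | zero =>
    have h := integral_cexp_quadratic (b := -1) (by norm_num) w 0
    rw [pow_zero, one_mul]
    convert h using 2
    · funext t
      rw [gaussDeriv_zero, Complex.ofReal_exp, ← Complex.exp_add]
      congr 1
      push_cast
      ring
    · rw [neg_neg, div_one, Real.sqrt_eq_rpow, Complex.ofReal_cpow Real.pi_pos.le]
      norm_num
    · congr 1
      ring
  | succ n ih =>
    have hv : ∀ t : ℝ, HasDerivAt (fun t : ℝ => Complex.exp (t * w)) (Complex.exp (t * w) * w) t :=
      fun t => by
        have := ((Complex.ofRealCLM.hasDerivAt (x := t)).mul_const w).cexp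
        simpa using this
    have hu : ∀ t : ℝ, HasDerivAt (fun t : ℝ => (gaussDeriv n t : ℂ))
        (gaussDeriv (n + 1) t : ℂ) t := fun t => (hasDerivAt_gaussDeriv n t).ofReal_comp
    have h := MeasureTheory.integral_mul_deriv_eq_deriv_mul_of_integrable
      (fun t _ => hu t) (fun t _ => hv t)
      (by simpa [Pi.mul_def, mul_assoc] using (integrable_gaussDeriv_mul_cexp n w).mul_const w)
      (integrable_gaussDeriv_mul_cexp (n + 1) w) (integrable_gaussDeriv_mul_cexp n w)
    rw [eq_neg_iff_add_eq_zero, add_comm, ← eq_neg_iff_add_eq_zero] at h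
    rw [h]
    simp only [← mul_assoc]
    rw [MeasureTheory.integral_mul_const, ih]
    ring

/-! ### Hermite functions -/

/-- The normalising factor `(2^{|α|} α!)^{-1/2}` of the Hermite functions. -/
def hermiteNorm {d : ℕ} (α : Fin d → ℕ) : ℝ :=
  (2 ^ (∑ j, α j) * ∏ j, ((α j).factorial : ℝ)) ^ (-(1 / 2 : ℝ))

theorem hermiteNorm_pos {d : ℕ} (α : Fin d → ℕ) : 0 < hermiteNorm α := by
  have : 0 < ∏ j, ((α j).factorial : ℝ) :=
    Finset.prod_pos fun j _ => Nat.cast_pos.2 (Nat.factorial_pos _)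
  unfold hermiteNorm
  positivity

/-- The Hermite functions without their normalising factor. -/
def hermiteRaw {d : ℕ} (α : Fin d → ℕ) (x : EuclideanSpace ℝ (Fin d)) : ℝ :=
  Real.exp (‖x‖ ^ 2 / 2) * ∏ j, gaussDeriv (α j) (x j)

theorem hermiteFun_eq {d : ℕ} (α : Fin d → ℕ) (x : EuclideanSpace ℝ (Fin d)) :
    hermiteFun α x =
      Real.pi ^ (-(d : ℝ) / 4) * (-1) ^ (∑ j, α j) * hermiteNorm α * hermiteRaw α x := by
  simp only [hermiteFun, hermiteNorm, hermiteRaw, gaussDeriv]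
  ring

theorem continuous_hermiteRaw {d : ℕ} (α : Fin d → ℕ) : Continuous (hermiteRaw α) := by
  have := fun n => continuous_gaussDeriv n
  unfold hermiteRaw
  fun_prop

theorem continuous_hermiteFun {d : ℕ} (α : Fin d → ℕ) : Continuous (hermiteFun α) := by
  rw [show hermiteFun α = fun x => Real.pi ^ (-(d : ℝ) / 4) * (-1) ^ (∑ j, α j) * hermiteNorm α *
    hermiteRaw α x from funext (hermiteFun_eq α)]
  exact (continuous_hermiteRaw α).const_mul _

theorem abs_hermiteRaw_le {d : ℕ} (α : Fin d → ℕ) :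
    ∃ C : ℝ, ∀ x, |hermiteRaw α x| ≤ C * Real.exp (-‖x‖ ^ 2 / 4) := by
  -- The rate `3/4` minus the `1/2` lost to `e^{‖x‖²/2}` leaves the `1/4` of the claim.
  choose C hC h using fun n => abs_gaussDeriv_le n (3 / 4) (by norm_num)
  refine ⟨∏ j, C (α j), fun x => ?_⟩
  calc |hermiteRaw α x| = Real.exp (‖x‖ ^ 2 / 2) * ∏ j, |gaussDeriv (α j) (x j)| := by
        rw [hermiteRaw, abs_mul, abs_of_pos (Real.exp_pos _), Finset.abs_prod]
    _ ≤ Real.exp (‖x‖ ^ 2 / 2) * ∏ j, (C (α j) * Real.exp (-(3 / 4) * x j ^ 2)) := by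
        gcongr with j
        exact h _ _
    _ = (∏ j, C (α j)) * Real.exp (-‖x‖ ^ 2 / 4) := by
        rw [Finset.prod_mul_distrib, ← Real.exp_sum, ← Finset.mul_sum, mul_left_comm,
          ← Real.exp_add, ← EuclideanSpace.real_norm_sq_eq]
        congr 2
        ring

theorem memLp_exp_neg_norm_sq (d : ℕ) :
    MeasureTheory.MemLp (fun x : EuclideanSpace ℝ (Fin d) => Real.exp (-‖x‖ ^ 2 / 4)) 2 := by
  rw [MeasureTheory.memLp_two_iff_integrable_sq
    (Continuous.aestronglyMeasurable (by fun_prop))]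
  have h := (gaussWindow_integrable d).const_mul ((Real.pi ^ (-(d : ℝ) / 4))⁻¹)
  refine h.congr (Filter.Eventually.of_forall fun x => ?_)
  have : (0 : ℝ) < Real.pi ^ (-(d : ℝ) / 4) := by positivity
  simp only [gaussWindow]
  rw [inv_mul_cancel_left₀ this.ne', ← Real.exp_nat_mul]
  congr 1
  push_cast
  ring

theorem integrable_mul_of_abs_le_gauss {d : ℕ} {v : EuclideanSpace ℝ (Fin d) → ℂ}
    (hv : MeasureTheory.MemLp v 2) {q : EuclideanSpace ℝ (Fin d) → ℝ} (hq : Continuous q)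
    (hC : ∃ C : ℝ, ∀ x, |q x| ≤ C * Real.exp (-‖x‖ ^ 2 / 4)) :
    MeasureTheory.Integrable fun x => v x * (q x : ℂ) := by
  obtain ⟨C, hC⟩ := hC
  have h : MeasureTheory.MemLp (fun x => (q x : ℂ)) 2 :=
    ((memLp_exp_neg_norm_sq d).const_mul C).mono'
      (Complex.continuous_ofReal.comp hq).aestronglyMeasurable
      (Filter.Eventually.of_forall fun x => by simpa using hC x)
  exact MeasureTheory.MemLp.integrable_mul hv h

theorem mul_hermiteRaw {d : ℕ} (α : Fin d → ℕ) (j : Fin d) (x : EuclideanSpace ℝ (Fin d)) :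
    x j * hermiteRaw α x = -(1 / 2) * hermiteRaw (Function.update α j (α j + 1)) x
      - α j * hermiteRaw (Function.update α j (α j - 1)) x := by
  have h : ∀ n : ℕ, hermiteRaw (Function.update α j n) x = Real.exp (‖x‖ ^ 2 / 2) *
      (gaussDeriv n (x j) * ∏ i ∈ Finset.univ.erase j, gaussDeriv (α i) (x i)) := fun n => by
    rw [hermiteRaw, ← Finset.mul_prod_erase _ _ (Finset.mem_univ j), Function.update_self]
    congr 2
    refine Finset.prod_congr rfl fun i hi => ?_
    rw [Function.update_of_ne (Finset.ne_of_mem_erase hi)]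
  have h0 := h (α j)
  rw [Function.update_eq_self] at h0
  rw [h, h, h0]
  linear_combination (Real.exp (‖x‖ ^ 2 / 2) *
    ∏ i ∈ Finset.univ.erase j, gaussDeriv (α i) (x i)) * mul_gaussDeriv (α j) (x j)

/-! ### Completeness of the Hermite system -/

/-- The linear span of the Hermite functions. -/
def hermiteSpan (d : ℕ) : Submodule ℝ (EuclideanSpace ℝ (Fin d) → ℝ) :=
  Submodule.span ℝ (Set.range hermiteRaw)

/-- By the three term recurrence. Since the span contains the Gaussian, it then contains every
polynomial multiple of it. -/
theorem coord_mul_mem_hermiteSpan {d : ℕ} {q : EuclideanSpace ℝ (Fin d) → ℝ}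
    (hq : q ∈ hermiteSpan d) (j : Fin d) : (fun x => x j * q x) ∈ hermiteSpan d := by
  induction hq using Submodule.span_induction with
  | mem q h =>
    obtain ⟨α, rfl⟩ := h
    rw [show (fun x => x j * hermiteRaw α x) =
      (-(1 / 2 : ℝ)) • hermiteRaw (Function.update α j (α j + 1))
      - (α j : ℝ) • hermiteRaw (Function.update α j (α j - 1)) from
        funext fun x => by simpa using mul_hermiteRaw α j x]
    exact Submodule.sub_mem _ (Submodule.smul_mem _ _ (Submodule.subset_span ⟨_, rfl⟩))
      (Submodule.smul_mem _ _ (Submodule.subset_span ⟨_, rfl⟩))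
  | zero =>
    convert! (hermiteSpan d).zero_mem using 1
    funext x
    simp
  | add q r _ _ hq hr =>
    convert! Submodule.add_mem _ hq hr using 1
    funext x
    simp [mul_add]
  | smul a q _ hq =>
    convert! Submodule.smul_mem _ a hq using 1
    funext x
    simp [mul_left_comm]

theorem inner_pow_mul_mem_hermiteSpan {d : ℕ} (ξ : EuclideanSpace ℝ (Fin d)) (n : ℕ) :
    (fun x => (inner ℝ x ξ : ℝ) ^ n * hermiteRaw 0 x) ∈ hermiteSpan d := by
  induction n with
  | zero => simpa using! Submodule.subset_span (Set.mem_range_self (0 : Fin d → ℕ))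
  | succ n ih =>
    have h : ∑ j, ξ j • (fun x : EuclideanSpace ℝ (Fin d) =>
        x j * ((inner ℝ x ξ : ℝ) ^ n * hermiteRaw 0 x)) ∈ hermiteSpan d :=
      Submodule.sum_mem _ fun j _ => Submodule.smul_mem _ _ (coord_mul_mem_hermiteSpan ih j)
    convert! h using 1
    funext x
    set c := (inner ℝ x ξ : ℝ) ^ n * hermiteRaw 0 x with hc
    rw [pow_succ', mul_assoc, ← hc, PiLp.inner_apply, Finset.sum_mul]
    simp only [Finset.sum_apply, Pi.smul_apply, smul_eq_mul, ← hc]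
    simp [mul_assoc]

theorem hermiteSpan_spec {d : ℕ} {v : EuclideanSpace ℝ (Fin d) → ℂ}
    (hv : MeasureTheory.MemLp v 2) (h0 : ∀ α, hermiteCoeff v α = 0)
    {q : EuclideanSpace ℝ (Fin d) → ℝ} (hq : q ∈ hermiteSpan d) :
    MeasureTheory.Integrable (fun x => v x * (q x : ℂ)) ∧ ∫ x, v x * (q x : ℂ) = 0 := by
  induction hq using Submodule.span_induction with
  | mem q h =>
    obtain ⟨α, rfl⟩ := h
    refine ⟨integrable_mul_of_abs_le_gauss hv (continuous_hermiteRaw α) (abs_hermiteRaw_le α), ?_⟩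
    have h := h0 α
    set c : ℝ := Real.pi ^ (-(d : ℝ) / 4) * (-1) ^ (∑ j, α j) * hermiteNorm α with hc
    have hc0 : (c : ℂ) ≠ 0 := by
      have h1 : (0 : ℝ) < Real.pi ^ (-(d : ℝ) / 4) := by positivity
      have h2 := hermiteNorm_pos α
      rw [Complex.ofReal_ne_zero, hc]
      have : (-1 : ℝ) ^ (∑ j, α j) ≠ 0 := by simp
      positivity
    have h3 : ∀ x, v x * (hermiteFun α x : ℂ) = c * (v x * (hermiteRaw α x : ℂ)) := fun x => by
      rw [hermiteFun_eq, ← hc, Complex.ofReal_mul]; ring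
    simp only [hermiteCoeff, h3, MeasureTheory.integral_const_mul] at h
    exact (mul_eq_zero.1 h).resolve_left hc0
  | zero => simp
  | add q r _ _ hq hr =>
    have h : ∀ x, v x * (((q + r) x : ℝ) : ℂ) = v x * (q x : ℂ) + v x * (r x : ℂ) := fun x => by
      simp [mul_add]
    simp only [h]
    exact ⟨hq.1.add hr.1, by rw [MeasureTheory.integral_add hq.1 hr.1, hq.2, hr.2, add_zero]⟩
  | smul a q _ hq =>
    have h : ∀ x, v x * (((a • q) x : ℝ) : ℂ) = a * (v x * (q x : ℂ)) := fun x => by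
      simp [mul_left_comm]
    simp only [h]
    exact ⟨hq.1.const_mul _, by rw [MeasureTheory.integral_const_mul, hq.2, mul_zero]⟩

theorem hermiteRaw_zero {d : ℕ} (x : EuclideanSpace ℝ (Fin d)) :
    hermiteRaw 0 x = Real.exp (-‖x‖ ^ 2 / 2) := by
  simp only [hermiteRaw, Pi.zero_apply, gaussDeriv_zero]
  rw [← Real.exp_sum, Finset.sum_neg_distrib, ← EuclideanSpace.real_norm_sq_eq, ← Real.exp_add]
  congr 1
  ring

/-- Expand the exponential: each term pairs `v` with an element of the Hermite span, and the series
is dominated by `‖v‖` times a Gaussian times `e^{|⟨x,ξ⟩|}`. -/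
theorem integral_gauss_mul_cexp_eq_zero {d : ℕ} {v : EuclideanSpace ℝ (Fin d) → ℂ}
    (hv : MeasureTheory.MemLp v 2) (h0 : ∀ α, hermiteCoeff v α = 0)
    (ξ : EuclideanSpace ℝ (Fin d)) :
    ∫ x, v x * (hermiteRaw 0 x : ℂ) * Complex.exp (Complex.I * (inner ℝ x ξ : ℝ)) = 0 := by
  have hs := fun n => hermiteSpan_spec hv h0 (inner_pow_mul_mem_hermiteSpan ξ n)
  have key := MeasureTheory.hasSum_integral_of_dominated_convergence
    (μ := MeasureTheory.volume)
    (F := fun (n : ℕ) (x : EuclideanSpace ℝ (Fin d)) => (Complex.I ^ n / (n.factorial : ℂ)) *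
      (v x * (((inner ℝ x ξ : ℝ) ^ n * hermiteRaw 0 x : ℝ) : ℂ)))
    (f := fun x => v x * (hermiteRaw 0 x : ℂ) * Complex.exp (Complex.I * (inner ℝ x ξ : ℝ)))
    (fun n x => ‖v x‖ * hermiteRaw 0 x * (|(inner ℝ x ξ : ℝ)| ^ n / n.factorial))
    (fun n => (hs n).1.aestronglyMeasurable.const_mul _)
    (fun n => Filter.Eventually.of_forall fun x => by
      rw [norm_mul, norm_mul, norm_div, norm_pow, Complex.norm_I, one_pow, Complex.norm_natCast,
        Complex.norm_real, norm_mul, norm_pow, Real.norm_eq_abs, Real.norm_eq_abs,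
        hermiteRaw_zero, Real.abs_exp]
      apply le_of_eq
      ring)
    (Filter.Eventually.of_forall fun x => (Real.summable_pow_div_factorial _).mul_left _)
    (by
      have h1 : (fun x : EuclideanSpace ℝ (Fin d) => ∑' n : ℕ, ‖v x‖ * hermiteRaw 0 x *
          (|(inner ℝ x ξ : ℝ)| ^ n / n.factorial)) =
          fun x => ‖v x * ((Real.exp (|(inner ℝ x ξ : ℝ)|) * hermiteRaw 0 x : ℝ) : ℂ)‖ := by
        funext x
        rw [tsum_mul_left, ← congrFun (NormedSpace.exp_eq_tsum_div (𝔸 := ℝ)),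
          ← Real.exp_eq_exp_ℝ, norm_mul, Complex.norm_real, norm_mul, Real.norm_eq_abs,
          Real.norm_eq_abs, hermiteRaw_zero, Real.abs_exp, Real.abs_exp]
        ring
      rw [h1]
      -- The constant comes from `|⟨x,ξ⟩| ≤ ‖x‖²/4 + ‖ξ‖²`.
      refine (integrable_mul_of_abs_le_gauss hv ?_ ⟨Real.exp (‖ξ‖ ^ 2), fun x => ?_⟩).norm
      · have := continuous_hermiteRaw (0 : Fin d → ℕ)
        fun_prop
      · rw [hermiteRaw_zero, abs_mul, Real.abs_exp, Real.abs_exp, ← Real.exp_add, ← Real.exp_add,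
          Real.exp_le_exp]
        have := abs_real_inner_le_norm x ξ
        nlinarith [sq_nonneg (‖x‖ / 2 - ‖ξ‖)])
    (Filter.Eventually.of_forall fun x => by
      have h := (NormedSpace.expSeries_div_hasSum_exp
        (Complex.I * (inner ℝ x ξ : ℝ))).mul_left (v x * (hermiteRaw 0 x : ℂ))
      rw [← Complex.exp_eq_exp_ℂ] at h
      convert! h using 1
      funext n
      push_cast
      ring)
  refine key.unique ?_
  convert! hasSum_zero (α := ℂ) (β := ℕ) using 1
  funext n
  rw [MeasureTheory.integral_const_mul, (hs n).2, mul_zero]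

/-- The product of `v` with the Gaussian is integrable with vanishing Fourier transform, hence zero;
the Gaussian never vanishes. -/
theorem ae_eq_zero_of_hermiteCoeff {d : ℕ} {v : EuclideanSpace ℝ (Fin d) → ℂ}
    (hv : MeasureTheory.MemLp v 2) (h0 : ∀ α, hermiteCoeff v α = 0) :
    ∀ᵐ x, v x = 0 := by
  set h : EuclideanSpace ℝ (Fin d) → ℂ := fun x => v x * (hermiteRaw 0 x : ℂ) with hh
  have hi : MeasureTheory.Integrable h :=
    integrable_mul_of_abs_le_gauss hv (continuous_hermiteRaw 0) (abs_hermiteRaw_le 0)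
  have hF : FourierTransform.fourier h = fun _ => (0 : ℂ) := by
    funext ξ
    rw [Real.fourier_eq']
    rw [← integral_gauss_mul_cexp_eq_zero hv h0 ((-2 * Real.pi) • ξ)]
    congr 1
    funext x
    rw [smul_eq_mul, mul_comm, inner_smul_right]
    congr 2
    push_cast
    ring
  have hz : ∀ᵐ x, h x = 0 := by
    refine ae_eq_zero_of_integral_contDiff_smul_eq_zero hi.locallyIntegrable fun g hg hgc => ?_
    have hg₁ : HasCompactSupport (Complex.ofRealCLM ∘ g) := hgc.comp_left rfl
    have hg₂ : ContDiff ℝ ((⊤ : ℕ∞) : WithTop ℕ∞) (Complex.ofRealCLM ∘ g) := by fun_prop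
    set k : SchwartzMap (EuclideanSpace ℝ (Fin d)) ℂ := hg₁.toSchwartzMap hg₂
    -- A test function is the Fourier transform of a Schwartz function, so the transform can be
    -- moved onto `h`, where it vanishes.
    obtain ⟨m, hm⟩ : ∃ m : SchwartzMap (EuclideanSpace ℝ (Fin d)) ℂ,
        FourierTransform.fourier m = k :=
      ⟨FourierTransformInv.fourierInv k, FourierTransform.fourier_fourierInv_eq k⟩
    have h1 := VectorFourier.integral_fourierIntegral_smul_eq_flip (μ := MeasureTheory.volume)
      (ν := MeasureTheory.volume) (L := innerₗ (EuclideanSpace ℝ (Fin d)))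
      Real.continuous_fourierChar continuous_inner m.integrable hi
    have h2 : ∀ x, k x = (g x : ℂ) := fun x => rfl
    calc ∫ x, g x • h x = ∫ x, k x • h x := by simp [h2]
      _ = ∫ x, m x • FourierTransform.fourier h x := by
          rw [← hm, SchwartzMap.fourier_coe]
          simpa using! h1
      _ = 0 := by simp [hF]
  filter_upwards [hz] with x hx
  refine (mul_eq_zero.1 hx).resolve_right ?_
  rw [hermiteRaw_zero]
  exact Complex.ofReal_ne_zero.2 (Real.exp_pos _).ne'

/-! ### Transforms of the Hermite functions in complex coordinates -/

/-- The point `x + iξ` of `ℂ^d`. -/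
def complexPoint {d : ℕ} (p : EuclideanSpace ℝ (Fin d) × EuclideanSpace ℝ (Fin d)) : Fin d → ℂ :=
  fun j => (p.1 j : ℂ) + Complex.I * (p.2 j : ℂ)

theorem sum_ofReal_mul_ofReal {d : ℕ} (y x : EuclideanSpace ℝ (Fin d)) :
    ∑ j, (y j : ℂ) * (x j : ℂ) = ((inner ℝ y x : ℝ) : ℂ) := by
  rw [PiLp.inner_apply]
  push_cast
  exact Finset.sum_congr rfl fun j _ => by simp [mul_comm]

theorem sum_ofReal_mul_complexPoint {d : ℕ} (y x ξ : EuclideanSpace ℝ (Fin d)) :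
    ∑ j, (y j : ℂ) * complexPoint (x, ξ) j =
      ((inner ℝ y x : ℝ) : ℂ) + Complex.I * ((inner ℝ y ξ : ℝ) : ℂ) := by
  rw [← sum_ofReal_mul_ofReal, ← sum_ofReal_mul_ofReal, Finset.mul_sum, ← Finset.sum_add_distrib]
  exact Finset.sum_congr rfl fun j _ => by simp only [complexPoint]; ring

theorem integral_euclideanSpace_prod {d : ℕ} (g : Fin d → ℝ → ℂ) :
    ∫ y : EuclideanSpace ℝ (Fin d), ∏ j, g j (y j) = ∏ j, ∫ t, g j t := by
  rw [← MeasureTheory.integral_fintype_prod_volume_eq_prod g]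
  exact (PiLp.volume_preserving_ofLp (Fin d)).integral_comp
    (MeasurableEquiv.toLp 2 (Fin d → ℝ)).symm.measurableEmbedding
    (fun y : Fin d → ℝ => ∏ j, g j (y j))

/-- The factor `e^{‖y‖²/2}` of `h_α` cancels the quadratic part of the window in `y`, so the
integrand splits over the coordinates. -/
theorem hermiteFun_mul_window_eq {d : ℕ} (α : Fin d → ℕ) (x ξ y : EuclideanSpace ℝ (Fin d)) :
    (hermiteFun α y : ℂ) * (gaussWindow d (y - x) : ℂ) *
      Complex.exp (Complex.I * ((inner ℝ y ξ : ℝ) : ℂ)) =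
    ((Real.pi ^ (-(d : ℝ) / 4) * Real.pi ^ (-(d : ℝ) / 4) * (-1) ^ (∑ j, α j) * hermiteNorm α *
      Real.exp (-‖x‖ ^ 2 / 2) : ℝ) : ℂ) *
      ∏ j, ((gaussDeriv (α j) (y j) : ℂ) * Complex.exp ((y j : ℂ) * complexPoint (x, ξ) j)) := by
  rw [Finset.prod_mul_distrib, ← Complex.exp_sum, sum_ofReal_mul_complexPoint, hermiteFun_eq,
    hermiteRaw, gaussWindow, Complex.exp_add]
  have h : Real.exp (‖y‖ ^ 2 / 2) * Real.exp (-‖y - x‖ ^ 2 / 2) =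
      Real.exp (-‖x‖ ^ 2 / 2) * Real.exp (inner ℝ y x) := by
    rw [← Real.exp_add, ← Real.exp_add, norm_sub_sq_real]
    congr 1
    ring
  have h' : (Real.exp (‖y‖ ^ 2 / 2) : ℂ) * (Real.exp (-‖y - x‖ ^ 2 / 2) : ℂ) =
      (Real.exp (-‖x‖ ^ 2 / 2) : ℂ) * Complex.exp ((inner ℝ y x : ℝ) : ℂ) := by
    rw [← Complex.ofReal_exp (inner ℝ y x)]
    exact_mod_cast h
  simp only [Complex.ofReal_mul, Complex.ofReal_prod]
  linear_combination ((Real.pi ^ (-(d : ℝ) / 4) : ℝ) : ℂ) * ((Real.pi ^ (-(d : ℝ) / 4) : ℝ) : ℂ) *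
    (((-1) ^ (∑ j, α j) : ℝ) : ℂ) * (hermiteNorm α : ℂ) *
    (∏ j, (gaussDeriv (α j) (y j) : ℂ)) *
    Complex.exp (Complex.I * ((inner ℝ y ξ : ℝ) : ℂ)) * h'

/-- The short-time Fourier transform of the Hermite functions, up to conjugation. -/
theorem integral_hermiteFun_mul_window {d : ℕ} (α : Fin d → ℕ) (x ξ : EuclideanSpace ℝ (Fin d)) :
    ∫ y, (hermiteFun α y : ℂ) * (gaussWindow d (y - x) : ℂ) *
      Complex.exp (Complex.I * ((inner ℝ y ξ : ℝ) : ℂ)) =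
    hermiteNorm α * (∏ j, complexPoint (x, ξ) j ^ α j) *
      Complex.exp (-(‖x‖ : ℂ) ^ 2 / 2 + (∑ j, complexPoint (x, ξ) j ^ 2) / 4) := by
  simp only [hermiteFun_mul_window_eq]
  rw [MeasureTheory.integral_const_mul, integral_euclideanSpace_prod (fun j t =>
    (gaussDeriv (α j) t : ℂ) * Complex.exp ((t : ℂ) * complexPoint (x, ξ) j))]
  simp only [integral_gaussDeriv_mul_cexp]
  rw [Finset.prod_mul_distrib, Finset.prod_mul_distrib, ← Complex.exp_sum, ← Finset.sum_div,
    Finset.prod_const, Finset.card_univ, Fintype.card_fin, Complex.exp_add]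
  have h1 : ∏ j, (-complexPoint (x, ξ) j) ^ α j =
      (-1) ^ (∑ j, α j) * ∏ j, complexPoint (x, ξ) j ^ α j := by
    rw [← Finset.prod_pow_eq_pow_sum, ← Finset.prod_mul_distrib]
    exact Finset.prod_congr rfl fun j _ => by rw [neg_pow]
  have h2 : Real.pi ^ (-(d : ℝ) / 4) * Real.pi ^ (-(d : ℝ) / 4) * Real.sqrt Real.pi ^ d = 1 := by
    rw [Real.sqrt_eq_rpow, ← Real.rpow_natCast, ← Real.rpow_mul Real.pi_pos.le,
      ← Real.rpow_add Real.pi_pos, ← Real.rpow_add Real.pi_pos]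
    ring_nf
    exact Real.rpow_zero _
  have h2' : ((Real.pi ^ (-(d : ℝ) / 4) : ℝ) : ℂ) * ((Real.pi ^ (-(d : ℝ) / 4) : ℝ) : ℂ) *
      (Real.sqrt Real.pi : ℂ) ^ d = 1 := by exact_mod_cast h2
  have h3 : ((-1 : ℂ) ^ (∑ j, α j)) * (-1) ^ (∑ j, α j) = 1 := by
    rw [← mul_pow]; norm_num
  have h4 : (Real.exp (-‖x‖ ^ 2 / 2) : ℂ) = Complex.exp (-(‖x‖ : ℂ) ^ 2 / 2) := by
    push_cast; rfl
  rw [h1]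
  simp only [Complex.ofReal_mul, h4]
  rw [Complex.ofReal_pow, Complex.ofReal_neg, Complex.ofReal_one]
  linear_combination (hermiteNorm α : ℂ) * (∏ j, complexPoint (x, ξ) j ^ α j) *
    Complex.exp (-(‖x‖ : ℂ) ^ 2 / 2) * Complex.exp ((∑ j, complexPoint (x, ξ) j ^ 2) / 4) *
    ((-1 : ℂ) ^ (∑ j, α j) * (-1) ^ (∑ j, α j) * h2' + h3)

open MeasureTheory

/-! ### Power series with superexponentially decaying coefficients -/

/-- The sequence `a` decays faster than every geometric sequence. -/
def SuperDecay {d : ℕ} (a : (Fin d → ℕ) → ℂ) : Prop :=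
  ∀ r : ℝ, 0 < r → ∃ C : ℝ, ∀ α, ‖a α‖ ≤ C * r ^ (∑ j, α j)

/-- The monomial `z^α`. -/
def mono {d : ℕ} (α : Fin d → ℕ) (z : Fin d → ℂ) : ℂ := ∏ j, z j ^ α j

theorem differentiable_mono {d : ℕ} (α : Fin d → ℕ) : Differentiable ℂ (mono α) := by
  unfold mono
  fun_prop

theorem continuous_mono {d : ℕ} (α : Fin d → ℕ) : Continuous (mono α) :=
  (differentiable_mono α).continuous

theorem norm_mono_le {d : ℕ} (α : Fin d → ℕ) {z : Fin d → ℂ} {T : ℝ} (hz : ‖z‖ ≤ T) :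
    ‖mono α z‖ ≤ T ^ (∑ j, α j) := by
  rw [mono, norm_prod, ← Finset.prod_pow_eq_pow_sum]
  refine Finset.prod_le_prod (fun _ _ => norm_nonneg _) fun j _ => ?_
  rw [norm_pow]
  exact pow_le_pow_left₀ (norm_nonneg _) ((norm_le_pi_norm z j).trans hz) _

theorem mono_mul {d : ℕ} (α : Fin d → ℕ) (u z : Fin d → ℂ) :
    mono α (u * z) = mono α u * mono α z := by
  simp only [mono, Pi.mul_apply, mul_pow, Finset.prod_mul_distrib]

theorem mono_star {d : ℕ} (α : Fin d → ℕ) (z : Fin d → ℂ) :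
    mono α (star z) = star (mono α z) := by
  simp [mono]

theorem summable_pow_sum (d : ℕ) {s : ℝ} (hs : 0 ≤ s) (hs1 : s < 1) :
    Summable fun α : Fin d → ℕ => s ^ (∑ j, α j) := by
  induction d with
  | zero => exact Summable.of_finite
  | succ d ih =>
    rw [← (Fin.consEquiv fun _ : Fin (d + 1) => ℕ).summable_iff]
    have h := (summable_geometric_of_lt_one hs hs1).mul_of_nonneg ih
      (fun n => pow_nonneg hs n) (fun n => pow_nonneg hs _)
    refine h.congr fun p => ?_
    simp [Fin.consEquiv, Fin.sum_univ_succ, pow_add]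

theorem SuperDecay.exists_summable {d : ℕ} {a : (Fin d → ℕ) → ℂ} (ha : SuperDecay a) {T : ℝ}
    (hT : 0 < T) : ∃ u : (Fin d → ℕ) → ℝ, Summable u ∧
      ∀ α z, ‖z‖ ≤ T → ‖a α * mono α z‖ ≤ u α := by
  -- With this rate, the terms on `‖z‖ ≤ T` are bounded by powers of `1/2`.
  obtain ⟨C, hC⟩ := ha (1 / (2 * T)) (by positivity)
  refine ⟨fun α => C * (1 / 2) ^ (∑ j, α j),
    (summable_pow_sum d (by norm_num) (by norm_num)).mul_left C, fun α z hz => ?_⟩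
  rw [norm_mul]
  calc ‖a α‖ * ‖mono α z‖ ≤ (C * (1 / (2 * T)) ^ (∑ j, α j)) * T ^ (∑ j, α j) :=
        mul_le_mul (hC α) (norm_mono_le α hz) (norm_nonneg _) ((norm_nonneg _).trans (hC α))
    _ = C * (1 / 2) ^ (∑ j, α j) := by
        rw [mul_assoc, ← mul_pow]
        congr 2
        field_simp

/-- A bound for the derivative of a holomorphic function of several variables in terms of its
supremum on a ball. -/
theorem norm_fderiv_le_of_bound {E : Type*} [NormedAddCommGroup E] [NormedSpace ℂ E]
    {f : E → ℂ} (hf : Differentiable ℂ f) {z : E} {M : ℝ}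
    (hM : ∀ w, ‖w‖ ≤ ‖z‖ + 1 → ‖f w‖ ≤ M) : ‖fderiv ℂ f z‖ ≤ M := by
  have hM0 : 0 ≤ M := (norm_nonneg _).trans (hM z (by linarith))
  refine ContinuousLinearMap.opNorm_le_of_unit_norm hM0 fun v hv => ?_
  have hl : ∀ s : ℂ, HasDerivAt (fun s : ℂ => z + s • v) v s := fun s => by
    simpa using ((hasDerivAt_id s).smul_const v).const_add z
  have hg : ∀ s : ℂ, HasDerivAt (fun s : ℂ => f (z + s • v)) (fderiv ℂ f (z + s • v) v) s :=
    fun s => (hf _).hasFDerivAt.comp_hasDerivAt s (hl s)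
  have h := Complex.norm_deriv_le_of_forall_mem_sphere_norm_le (c := 0) (C := M) one_pos
    (f := fun s : ℂ => f (z + s • v))
    (Differentiable.diffContOnCl fun s => (hg s).differentiableAt) fun s hs => hM _ ?_
  · rw [(hg 0).deriv] at h
    simpa using h
  · rw [mem_sphere_zero_iff_norm] at hs
    refine (norm_add_le _ _).trans ?_
    rw [norm_smul, hs, hv, one_mul]

theorem SuperDecay.differentiable {d : ℕ} {a : (Fin d → ℕ) → ℂ} (ha : SuperDecay a) :
    Differentiable ℂ fun z => ∑' α, a α * mono α z := by
  intro z
  -- One unit of radius gives a ball around `z`, the second one is used by the Cauchy estimate for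
  -- the derivatives.
  obtain ⟨u, hu, h⟩ := ha.exists_summable (T := ‖z‖ + 2) (by positivity)
  have hd : ∀ α, Differentiable ℂ fun z => a α * mono α z :=
    fun α => (differentiable_mono α).const_mul _
  refine (hasFDerivAt_tsum_of_isPreconnected (f := fun α z => a α * mono α z) (x₀ := z)
    (s := Metric.ball 0 (‖z‖ + 1)) hu Metric.isOpen_ball
    (convex_ball 0 (‖z‖ + 1)).isPreconnected
    (fun α x _ => (hd α x).hasFDerivAt)
    (fun α x hx => norm_fderiv_le_of_bound (hd α) fun w hw => h α w ?_)
    (by simp) (Summable.of_norm_bounded hu fun α => h α z (by linarith))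
    (by simp)).differentiableAt
  rw [mem_ball_zero_iff] at hx
  linarith

/-! ### Measures on polydiscs that are invariant under the torus -/

/-- Finite measures on `ℂ^d` with bounded support that are invariant under the action of the torus
and not concentrated near the coordinate hyperplanes. -/
structure IsReinhardtMeasure {d : ℕ} (μ : Measure (Fin d → ℂ)) : Prop where
  finite : IsFiniteMeasure μ
  bounded : ∃ T : ℝ, 0 < T ∧ ∀ᵐ w ∂μ, ‖w‖ ≤ T
  rotation : ∀ u : Fin d → ℂ, (∀ j, ‖u j‖ = 1) → MeasurePreserving (fun w => u * w) μ μ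
  lower : ∃ ρ : ℝ, 0 < ρ ∧ μ {w | ∀ j, ρ ≤ ‖w j‖} ≠ 0

namespace IsReinhardtMeasure

variable {d : ℕ} {μ : Measure (Fin d → ℂ)}

theorem integrable (hμ : IsReinhardtMeasure μ) {F : Type*} [NormedAddCommGroup F]
    {g : (Fin d → ℂ) → F} (hg : Continuous g) : Integrable g μ := by
  have := hμ.finite
  obtain ⟨T, -, hT⟩ := hμ.bounded
  obtain ⟨M, hM⟩ := (isCompact_closedBall (0 : Fin d → ℂ) T).exists_bound_of_continuousOn
    hg.continuousOn
  refine Integrable.of_bound hg.aestronglyMeasurable M ?_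
  filter_upwards [hT] with w hw using hM w (by simpa using hw)

theorem integral_rotation (hμ : IsReinhardtMeasure μ) {u : Fin d → ℂ} (hu : ∀ j, ‖u j‖ = 1)
    {g : (Fin d → ℂ) → ℂ} (hg : Continuous g) : ∫ w, g (u * w) ∂μ = ∫ w, g w ∂μ := by
  have h := hμ.rotation u hu
  conv_rhs => rw [← h.map_eq]
  rw [integral_map h.measurable.aemeasurable hg.aestronglyMeasurable]

/-- In a coordinate `j` where the exponents differ, rotation by `π / (α_j - β_j)` changes the sign
of the integrand. -/
theorem integral_mono_orthogonal (hμ : IsReinhardtMeasure μ) {α β : Fin d → ℕ} (h : β ≠ α) :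
    ∫ w, star (mono β w) * mono α w ∂μ = 0 := by
  obtain ⟨j, hj⟩ := Function.ne_iff.1 h
  have hj' : ((α j : ℝ) - β j) ≠ 0 := sub_ne_zero.2 (by exact_mod_cast hj.symm)
  set θ : ℝ := Real.pi / ((α j : ℝ) - β j) with hθ
  set u : Fin d → ℂ := Function.update 1 j (Complex.exp (θ * Complex.I)) with hu
  have hu1 : ∀ i, ‖u i‖ = 1 := fun i => by
    rw [hu, Function.update_apply]
    split_ifs <;> simp [Complex.norm_exp_ofReal_mul_I]
  have hm : ∀ γ : Fin d → ℕ, mono γ u = Complex.exp (θ * Complex.I) ^ γ j := fun γ => by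
    rw [mono, Finset.prod_eq_single j]
    · rw [hu, Function.update_self]
    · intro i _ hi
      rw [hu, Function.update_of_ne hi, Pi.one_apply, one_pow]
    · simp
  have hc : star (mono β u) * mono α u = -1 := by
    rw [hm, hm, ← Complex.exp_nat_mul, ← Complex.exp_nat_mul, Complex.star_def, ← Complex.exp_conj,
      ← Complex.exp_add, ← Complex.exp_pi_mul_I]
    congr 1
    have : (Real.pi : ℂ) = θ * ((α j : ℂ) - β j) := by
      rw [hθ]
      exact_mod_cast (div_mul_cancel₀ Real.pi hj').symm
    rw [this]
    simp
    ring
  have hi := hμ.integral_rotation hu1 (g := fun w => star (mono β w) * mono α w)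
    ((continuous_star.comp (continuous_mono β)).mul (continuous_mono α))
  have h2 : ∀ w, star (mono β (u * w)) * mono α (u * w) = -(star (mono β w) * mono α w) :=
    fun w => by
      rw [mono_mul, mono_mul, star_mul']
      linear_combination (star (mono β w) * mono α w) * hc
  simp only [h2, integral_neg] at hi
  exact self_eq_neg.1 hi.symm

/-- Only the region where all `|w_j| ≥ ρ` is kept. A geometric lower bound is enough for division by
these moments to preserve superexponential decay. -/
theorem exists_le_moment (hμ : IsReinhardtMeasure μ) : ∃ ρ κ : ℝ, 0 < ρ ∧ 0 < κ ∧
    ∀ α : Fin d → ℕ, κ * (ρ ^ 2) ^ (∑ j, α j) ≤ ∫ w, ‖mono α w‖ ^ 2 ∂μ := by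
  have := hμ.finite
  obtain ⟨ρ, hρ, h⟩ := hμ.lower
  set S : Set (Fin d → ℂ) := {w | ∀ j, ρ ≤ ‖w j‖} with hS
  have hSm : MeasurableSet S := by
    rw [hS, Set.ofPred_forall]
    exact MeasurableSet.iInter fun j => (isClosed_le continuous_const (by fun_prop)).measurableSet
  refine ⟨ρ, μ.real S, hρ, ?_, fun α => ?_⟩
  · exact ENNReal.toReal_pos h (measure_ne_top _ _)
  · have hi : Integrable (fun w => ‖mono α w‖ ^ 2) μ :=
      hμ.integrable ((continuous_mono α).norm.pow 2)
    calc μ.real S * (ρ ^ 2) ^ (∑ j, α j) = ∫ _ in S, (ρ ^ 2) ^ (∑ j, α j) ∂μ := by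
          rw [setIntegral_const, smul_eq_mul]
      _ ≤ ∫ w in S, ‖mono α w‖ ^ 2 ∂μ := by
          refine setIntegral_mono_on (integrableOn_const (measure_ne_top _ _)) hi.integrableOn hSm
            fun w hw => ?_
          rw [← pow_mul, mul_comm, pow_mul]
          refine pow_le_pow_left₀ (by positivity) ?_ 2
          rw [mono, norm_prod, ← Finset.prod_pow_eq_pow_sum]
          refine Finset.prod_le_prod (fun _ _ => by positivity) fun j _ => ?_
          rw [norm_pow]
          exact pow_le_pow_left₀ hρ.le (hw j) _
      _ ≤ ∫ w, ‖mono α w‖ ^ 2 ∂μ :=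
          setIntegral_le_integral hi (Filter.Eventually.of_forall fun w => by positivity)

/-- Every superexponentially decaying sequence is the sequence of antiholomorphic moments of an
entire function. -/
theorem exists_entire_moments (hμ : IsReinhardtMeasure μ) {a : (Fin d → ℕ) → ℂ}
    (ha : SuperDecay a) : ∃ K : (Fin d → ℂ) → ℂ, Differentiable ℂ K ∧
      ∀ α, ∫ w, K (star w) * mono α w ∂μ = a α := by
  have := hμ.finite
  obtain ⟨ρ, κ, hρ, hκ, hm⟩ := hμ.exists_le_moment
  set m : (Fin d → ℕ) → ℝ := fun α => ∫ w, ‖mono α w‖ ^ 2 ∂μ with hmdef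
  have hm0 : ∀ α, 0 < m α := fun α => lt_of_lt_of_le (by positivity) (hm α)
  have hg : SuperDecay fun α => a α / m α := fun r hr => by
    obtain ⟨C, hC⟩ := ha (r * ρ ^ 2) (by positivity)
    refine ⟨C / κ, fun α => ?_⟩
    rw [norm_div, Complex.norm_real, Real.norm_of_nonneg (hm0 α).le, div_le_iff₀ (hm0 α)]
    calc ‖a α‖ ≤ C * (r * ρ ^ 2) ^ (∑ j, α j) := hC α
      _ = C / κ * r ^ (∑ j, α j) * (κ * (ρ ^ 2) ^ (∑ j, α j)) := by
          rw [mul_pow]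
          field_simp
      _ ≤ C / κ * r ^ (∑ j, α j) * m α := by
          have h0 : 0 ≤ C := by
            have := (norm_nonneg _).trans (hC 0)
            simpa using this
          have := hm α
          gcongr
  -- The witness is `K(z) = Σ (a_β / m_β) z^β`; after termwise integration only `β = α` survives.
  refine ⟨_, hg.differentiable, fun α => ?_⟩
  obtain ⟨T, hT, hTw⟩ := hμ.bounded
  obtain ⟨u, hu, hub⟩ := hg.exists_summable hT
  have hMα : ∀ w, ‖w‖ ≤ T → ‖mono α w‖ ≤ T ^ (∑ j, α j) := fun w hw => norm_mono_le α hw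
  have key := hasSum_integral_of_dominated_convergence (μ := μ)
    (F := fun (β : Fin d → ℕ) w => a β / m β * mono β (star w) * mono α w)
    (f := fun w => (∑' β, a β / m β * mono β (star w)) * mono α w)
    (fun β _ => u β * T ^ (∑ j, α j))
    (fun β => by
      have := continuous_mono β
      have := continuous_mono α
      exact Continuous.aestronglyMeasurable (by fun_prop))
    (fun β => by
      filter_upwards [hTw] with w hw
      rw [norm_mul]
      exact mul_le_mul (hub β _ (by simpa using hw)) (hMα w hw) (norm_nonneg _)
        ((norm_nonneg _).trans (hub β _ (by simpa using hw))))
    (Filter.Eventually.of_forall fun w => hu.mul_right _)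
    (integrable_const _)
    (by
      filter_upwards [hTw] with w hw
      exact (Summable.of_norm_bounded hu fun β =>
        hub β (star w) (by simpa using hw)).hasSum.mul_right _)
  refine key.unique ?_
  convert! hasSum_ite_eq α (a α) using 1
  funext β
  have h1 : ∫ w, a β / m β * mono β (star w) * mono α w ∂μ =
      a β / m β * ∫ w, star (mono β w) * mono α w ∂μ := by
    rw [← integral_const_mul]
    congr 1
    funext w
    rw [mono_star, mul_assoc]
  rw [h1]
  split_ifs with h
  · subst h
    have h2 : ∫ w, star (mono β w) * mono β w ∂μ = (m β : ℂ) := by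
      rw [hmdef, ← integral_complex_ofReal]
      congr 1
      funext w
      rw [Complex.star_def, ← Complex.normSq_eq_conj_mul_self, Complex.normSq_eq_norm_sq]
    rw [h2, div_mul_cancel₀]
    exact_mod_cast (hm0 β).ne'
  · rw [hμ.integral_mono_orthogonal h, mul_zero]

end IsReinhardtMeasure

/-! ### Moments with a Gaussian factor -/

/-- The average over a circle around the origin does not depend on the radius, for functions that
are holomorphic away from the origin. -/
theorem circleAverage_eq_of_differentiableAt {f : ℂ → ℂ} (hf : ∀ z ≠ 0, DifferentiableAt ℂ f z)
    {R : ℝ} (hR : 1 ≤ R) : Real.circleAverage f 0 1 = Real.circleAverage f 0 R := by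
  rw [Real.circleAverage_eq_circleIntegral (by positivity),
    Real.circleAverage_eq_circleIntegral (by positivity)]
  congr 1
  refine (Complex.circleIntegral_sub_center_inv_smul_eq_of_differentiable_on_annulus_off_countable
    one_pos hR Set.countable_empty (fun z hz => (hf z ?_).continuousAt.continuousWithinAt)
    fun z hz => hf z ?_).symm
  · rintro rfl
    simp at hz
  · rintro rfl
    simp at hz

theorem norm_circleAverage_le {f : ℂ → ℂ} {R M : ℝ} (hR : 0 ≤ R) (hM : ∀ z, ‖z‖ = R → ‖f z‖ ≤ M) :
    ‖Real.circleAverage f 0 R‖ ≤ M := by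
  rw [Real.circleAverage_def, norm_smul]
  have h := intervalIntegral.norm_integral_le_of_norm_le_const (a := 0) (b := 2 * Real.pi)
    (f := fun θ => f (circleMap 0 R θ)) (C := M) fun θ _ => hM _ (by simp [abs_of_nonneg hR])
  have hp := Real.pi_pos
  rw [sub_zero, abs_of_pos (by positivity)] at h
  rw [Real.norm_of_nonneg (by positivity), inv_mul_le_iff₀ (by positivity), mul_comm _ M]
  exact h

/-- The quadratic form `∑ w_j²`. -/
def sumSq {d : ℕ} (w : Fin d → ℂ) : ℂ := ∑ j, w j ^ 2

theorem differentiable_sumSq {d : ℕ} : Differentiable ℂ (sumSq (d := d)) := by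
  unfold sumSq
  fun_prop

namespace IsReinhardtMeasure

variable {d : ℕ} {μ : Measure (Fin d → ℂ)}

/-- Substituting `z⁻¹w` for `w` with `|z| = 1` preserves `μ` and turns `w̄` into `z w̄`. Written
this way, the dependence on `z` is holomorphic off the origin when `K` and `q` are entire. -/
theorem integral_eq_integral_circleAverage (hμ : IsReinhardtMeasure μ)
    {K q : (Fin d → ℂ) → ℂ} (hK : Continuous K) (hq : Continuous q) :
    ∫ w, K (star w) * q w ∂μ =
      ∫ w, Real.circleAverage (fun z => K (z • star w) * q (z⁻¹ • w)) 0 1 ∂μ := by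
  have := hμ.finite
  have hrot : ∀ θ : ℝ, ∫ w, K (circleMap 0 1 θ • star w) * q ((circleMap 0 1 θ)⁻¹ • w) ∂μ =
      ∫ w, K (star w) * q w ∂μ := fun θ => by
    have h1 : ‖circleMap 0 1 θ‖ = 1 := by simp
    have h := hμ.integral_rotation (u := fun _ => (circleMap 0 1 θ)⁻¹)
      (fun _ => by rw [norm_inv, h1, inv_one]) (g := fun w => K (star w) * q w) (by fun_prop)
    rw [← h]
    congr 1
    funext w
    have h2 : star ((fun _ : Fin d => (circleMap 0 1 θ)⁻¹) * w) = circleMap 0 1 θ • star w := by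
      funext j
      have h3 : star (circleMap 0 1 θ)⁻¹ = circleMap 0 1 θ := by
        rw [star_inv₀, inv_eq_iff_eq_inv, Complex.inv_def, Complex.normSq_eq_norm_sq, h1]
        simp
      simp only [Pi.star_apply, Pi.mul_apply, Pi.smul_apply, smul_eq_mul, star_mul', h3]
    rw [h2]
    rfl
  have hc : Continuous fun p : (Fin d → ℂ) × ℝ =>
      K (circleMap 0 1 p.2 • star p.1) * q ((circleMap 0 1 p.2)⁻¹ • p.1) := by
    have h1 : Continuous fun p : (Fin d → ℂ) × ℝ => circleMap 0 1 p.2 :=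
      (continuous_circleMap 0 1).comp continuous_snd
    have h2 : Continuous fun p : (Fin d → ℂ) × ℝ => (circleMap 0 1 p.2)⁻¹ :=
      h1.inv₀ fun p => circleMap_ne_center one_ne_zero
    fun_prop
  simp only [Real.circleAverage_def]
  rw [integral_smul]
  simp only [intervalIntegral.integral_of_le Real.two_pi_pos.le]
  rw [integral_integral_swap]
  · simp only [hrot]
    rw [setIntegral_const]
    simp only [measureReal_def, Real.volume_Ioc, sub_zero,
      ENNReal.toReal_ofReal Real.two_pi_pos.le, smul_smul, inv_mul_cancel₀ Real.two_pi_pos.ne',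
      one_smul]
  · obtain ⟨T, -, hT⟩ := hμ.bounded
    obtain ⟨M, hM⟩ := (isCompact_closedBall (0 : Fin d → ℂ) T).exists_bound_of_continuousOn
      hK.continuousOn
    obtain ⟨M', hM'⟩ := (isCompact_closedBall (0 : Fin d → ℂ) T).exists_bound_of_continuousOn
      hq.continuousOn
    refine Integrable.of_bound (hc.aestronglyMeasurable) (M * M') ?_
    have hfst : ∀ᵐ p ∂(μ.prod (volume.restrict (Set.Ioc 0 (2 * Real.pi)))), ‖p.1‖ ≤ T :=
      Measure.quasiMeasurePreserving_fst.ae hT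
    filter_upwards [hfst] with p hp
    have h1 : ‖K (circleMap 0 1 p.2 • star p.1)‖ ≤ M :=
      hM _ (by rw [mem_closedBall_zero_iff, norm_smul]; simpa using hp)
    have h2 : ‖q ((circleMap 0 1 p.2)⁻¹ • p.1)‖ ≤ M' :=
      hM' _ (by rw [mem_closedBall_zero_iff, norm_smul]; simpa using hp)
    simp only [Function.uncurry, norm_mul]
    exact mul_le_mul h1 h2 (norm_nonneg _) ((norm_nonneg _).trans h1)

/-- The antiholomorphic moments of an entire function, with a holomorphic factor, decay
superexponentially. -/
theorem superDecay_moments (hμ : IsReinhardtMeasure μ) {K E : (Fin d → ℂ) → ℂ}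
    (hK : Differentiable ℂ K) (hE : Differentiable ℂ E) :
    SuperDecay fun α => ∫ w, K (star w) * (E w * mono α w) ∂μ := by
  intro r hr
  have := hμ.finite
  obtain ⟨T, hT, hTw⟩ := hμ.bounded
  -- On `|z| = R` one has `‖z⁻¹w‖ ≤ T/R ≤ r`, which yields `r^{|α|}`; as `R ≥ 1`, the factor `E` is
  -- only evaluated on the ball of radius `T`.
  set R : ℝ := max 1 (T / r) with hR
  have hR1 : 1 ≤ R := le_max_left _ _
  have hR0 : 0 < R := by positivity
  obtain ⟨M, hM⟩ := (isCompact_closedBall (0 : Fin d → ℂ) (R * T)).exists_bound_of_continuousOn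
    hK.continuous.continuousOn
  obtain ⟨M', hM'⟩ := (isCompact_closedBall (0 : Fin d → ℂ) T).exists_bound_of_continuousOn
    hE.continuous.continuousOn
  refine ⟨M * M' * μ.real Set.univ, fun α => ?_⟩
  beta_reduce
  rw [hμ.integral_eq_integral_circleAverage hK.continuous
    (q := fun w => E w * mono α w) (hE.continuous.mul (continuous_mono α))]
  calc _ ≤ M * (M' * r ^ (∑ j, α j)) * μ.real Set.univ := by
        refine norm_integral_le_of_norm_le_const ?_
        filter_upwards [hTw] with w hw
        rw [circleAverage_eq_of_differentiableAt _ hR1]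
        · refine norm_circleAverage_le hR0.le fun z hz => ?_
          have hw' : ‖z⁻¹ • w‖ ≤ T / R := by
            rw [norm_smul, norm_inv, hz, inv_mul_eq_div]
            gcongr
          have hTR : T / R ≤ r := by
            rw [div_le_iff₀ hR0, ← div_le_iff₀' hr]
            exact le_max_right _ _
          have h1 : ‖K (z • star w)‖ ≤ M := hM _ (by
            rw [mem_closedBall_zero_iff, norm_smul, hz, norm_star]
            gcongr)
          have h2 : ‖E (z⁻¹ • w)‖ ≤ M' := hM' _ (by
            rw [mem_closedBall_zero_iff]
            exact hw'.trans (div_le_self hT.le hR1))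
          have h3 : ‖mono α (z⁻¹ • w)‖ ≤ r ^ (∑ j, α j) := norm_mono_le α (hw'.trans hTR)
          rw [norm_mul, norm_mul]
          have hM0 : 0 ≤ M := (norm_nonneg _).trans h1
          have hM0' : 0 ≤ M' := (norm_nonneg _).trans h2
          gcongr
        · intro z hz
          have h1 : DifferentiableAt ℂ (fun z : ℂ => z • star w) z := by fun_prop
          have h2 : DifferentiableAt ℂ (fun z : ℂ => z⁻¹ • w) z :=
            (differentiableAt_inv hz).smul_const w
          exact ((hK _).comp z h1).mul
            (((hE.mul (differentiable_mono α)) _).comp z h2)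
    _ = _ := by ring

theorem integral_mul_eval_eq (hμ : IsReinhardtMeasure μ) {H₁ H₂ : (Fin d → ℂ) → ℂ}
    (h₁ : Continuous H₁) (h₂ : Continuous H₂)
    (h : ∀ α, ∫ w, H₁ w * mono α w ∂μ = ∫ w, H₂ w * mono α w ∂μ) (P : MvPolynomial (Fin d) ℂ) :
    ∫ w, H₁ w * MvPolynomial.eval w P ∂μ = ∫ w, H₂ w * MvPolynomial.eval w P ∂μ := by
  induction P using MvPolynomial.induction_on' with
  | monomial s a =>
    have hs : ∀ (H : (Fin d → ℂ) → ℂ) w, H w * MvPolynomial.eval w (MvPolynomial.monomial s a) =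
        a * (H w * mono s w) := fun H w => by
      rw [MvPolynomial.eval_monomial, Finsupp.prod_fintype _ _ (by simp), mono]
      ring
    simp only [hs, integral_const_mul, h]
  | add P Q hP hQ =>
    have hc : ∀ P : MvPolynomial (Fin d) ℂ, Continuous fun w => MvPolynomial.eval w P :=
      fun P => MvPolynomial.continuous_eval P
    simp only [map_add, mul_add]
    have hi : ∀ {H : (Fin d → ℂ) → ℂ}, Continuous H → ∀ P : MvPolynomial (Fin d) ℂ,
        Integrable (fun w => H w * MvPolynomial.eval w P) μ :=
      fun hH P => hμ.integrable (hH.mul (hc P))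
    rw [integral_add (hi h₁ P) (hi h₁ Q), integral_add (hi h₂ P) (hi h₂ Q), hP, hQ]

theorem hasSum_integral_mul_exp (hμ : IsReinhardtMeasure μ) {H q : (Fin d → ℂ) → ℂ}
    (hH : Continuous H) (hq : Continuous q) :
    HasSum (fun n : ℕ => ∫ w, H w * (q w ^ n / n.factorial) ∂μ)
      (∫ w, H w * Complex.exp (q w) ∂μ) := by
  refine hasSum_integral_of_dominated_convergence
    (fun n w => ‖H w‖ * (‖q w‖ ^ n / n.factorial))
    (fun n => Continuous.aestronglyMeasurable (by fun_prop))
    (fun n => Filter.Eventually.of_forall fun w => by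
      rw [norm_mul, norm_div, norm_pow, Complex.norm_natCast])
    (Filter.Eventually.of_forall fun w => (Real.summable_pow_div_factorial _).mul_left _)
    ?_ (Filter.Eventually.of_forall fun w => ?_)
  · have h1 : (fun w => ∑' n : ℕ, ‖H w‖ * (‖q w‖ ^ n / n.factorial)) =
        fun w => ‖H w‖ * Real.exp ‖q w‖ := by
      funext w
      rw [tsum_mul_left, ← congrFun (NormedSpace.exp_eq_tsum_div (𝔸 := ℝ)), ← Real.exp_eq_exp_ℝ]
    rw [h1]
    exact hμ.integrable (by fun_prop)
  · rw [Complex.exp_eq_exp_ℂ]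
    exact (NormedSpace.expSeries_div_hasSum_exp (q w)).mul_left _

/-- Every superexponentially decaying sequence is the sequence of antiholomorphic moments of an
entire function, with a prescribed factor `e^{s ∑ w_j²}`. -/
theorem exists_entire_gaussian_moments (hμ : IsReinhardtMeasure μ) {a : (Fin d → ℕ) → ℂ}
    (ha : SuperDecay a) (s : ℂ) : ∃ G : (Fin d → ℂ) → ℂ, Differentiable ℂ G ∧
      ∀ α, ∫ w, G (star w) * (Complex.exp (s * sumSq w) * mono α w) ∂μ = a α := by
  obtain ⟨k, hk, hka⟩ := hμ.exists_entire_moments ha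
  have hQ := differentiable_sumSq (d := d)
  have hQc := hQ.continuous
  -- `G(w̄)` acts as the antiholomorphic part of `k(w̄) e^{-sQ}`: both have the same integrals
  -- against every `w^α`.
  obtain ⟨G, hG, hGb⟩ := hμ.exists_entire_moments
    (hμ.superDecay_moments hk (E := fun w => Complex.exp (-s * sumSq w)) (by fun_prop))
  have hkc := hk.continuous
  have hGc := hG.continuous
  refine ⟨G, hG, fun α => ?_⟩
  have hα := continuous_mono α
  set Q : MvPolynomial (Fin d) ℂ := MvPolynomial.C s * ∑ j, MvPolynomial.X j ^ 2 with hQdef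
  set A : MvPolynomial (Fin d) ℂ := ∏ j, MvPolynomial.X j ^ α j with hA
  have hQe : ∀ w, MvPolynomial.eval w Q = s * sumSq w := fun w => by
    simp [hQdef, sumSq, map_sum]
  have hAe : ∀ w, MvPolynomial.eval w A = mono α w := fun w => by
    simp [hA, mono, map_prod]
  have h1 := hμ.hasSum_integral_mul_exp (H := fun w => G (star w) * mono α w)
    (q := fun w => s * sumSq w) (by fun_prop) (by fun_prop)
  have h2 := hμ.hasSum_integral_mul_exp
    (H := fun w => k (star w) * Complex.exp (-s * sumSq w) * mono α w)
    (q := fun w => s * sumSq w) (by fun_prop) (by fun_prop)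
  -- Each term of the series of `e^{sQ} w^α` is a polynomial in `w`, so equality of moments applies
  -- to it.
  have h3 : ∀ n : ℕ, ∫ w, G (star w) * mono α w * ((s * sumSq w) ^ n / n.factorial) ∂μ =
      ∫ w, k (star w) * Complex.exp (-s * sumSq w) * mono α w *
        ((s * sumSq w) ^ n / n.factorial) ∂μ := fun n => by
    have h := hμ.integral_mul_eval_eq (H₁ := fun w => G (star w))
      (H₂ := fun w => k (star w) * Complex.exp (-s * sumSq w)) (by fun_prop) (by fun_prop)
      (fun β => by simp only [hGb, mul_assoc]) (A * Q ^ n * MvPolynomial.C (n.factorial : ℂ)⁻¹)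
    simp only [map_mul, map_pow, hQe, hAe, MvPolynomial.eval_C] at h
    simpa only [div_eq_mul_inv, mul_assoc] using h
  simp only [h3] at h1
  have h4 := h1.unique h2
  rw [← hka α]
  calc _ = ∫ w, G (star w) * mono α w * Complex.exp (s * sumSq w) ∂μ := by
        congr 1; funext w; ring
    _ = _ := h4
    _ = _ := by
        congr 1
        funext w
        have : Complex.exp (-s * sumSq w) * Complex.exp (s * sumSq w) = 1 := by
          rw [← Complex.exp_add]; simp
        linear_combination k (star w) * mono α w * this

end IsReinhardtMeasure

/-! ### The adjoint of the short-time Fourier transform as a function -/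

/-- The function that represents the distribution `V_φ^* F`. -/
def stftAdjointFun {d : ℕ} (F : EuclideanSpace ℝ (Fin d) × EuclideanSpace ℝ (Fin d) → ℂ)
    (y : EuclideanSpace ℝ (Fin d)) : ℂ :=
  ∫ p, F p * ((gaussWindow d (y - p.1) : ℂ) *
    Complex.exp (Complex.I * ((inner ℝ y p.2 : ℝ) : ℂ)))

section Adjoint

variable {d : ℕ} {F : EuclideanSpace ℝ (Fin d) × EuclideanSpace ℝ (Fin d) → ℂ}

theorem norm_window_mul_cexp (x ξ y : EuclideanSpace ℝ (Fin d)) :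
    ‖(gaussWindow d (y - x) : ℂ) * Complex.exp (Complex.I * ((inner ℝ y ξ : ℝ) : ℂ))‖ =
      gaussWindow d (y - x) := by
  rw [norm_mul, Complex.norm_exp, Complex.norm_real,
    Real.norm_of_nonneg (gaussWindow_nonneg d _)]
  simp

theorem integrable_adjoint_kernel (hF : Integrable F) {g : EuclideanSpace ℝ (Fin d) → ℂ}
    (hg : Continuous g) {M : ℝ} (hM : ∀ y, ‖g y‖ ≤ M) :
    Integrable (fun q : (EuclideanSpace ℝ (Fin d) × EuclideanSpace ℝ (Fin d)) ×
        EuclideanSpace ℝ (Fin d) =>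
      F q.1 * ((gaussWindow d (q.2 - q.1.1) : ℂ) *
        Complex.exp (Complex.I * ((inner ℝ q.2 q.1.2 : ℝ) : ℂ))) * g q.2)
      (volume.prod volume) := by
  have hgw := gaussWindow_continuous d
  have h0 : Integrable (fun q : (EuclideanSpace ℝ (Fin d) × EuclideanSpace ℝ (Fin d)) ×
        EuclideanSpace ℝ (Fin d) =>
      F q.1 * ((gaussWindow d (q.2 - q.1.1) : ℂ) *
        Complex.exp (Complex.I * ((inner ℝ q.2 q.1.2 : ℝ) : ℂ)))) (volume.prod volume) := by
    rw [integrable_prod_iff]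
    · have h1 : ∀ p y, ‖F p * ((gaussWindow d (y - p.1) : ℂ) *
          Complex.exp (Complex.I * ((inner ℝ y p.2 : ℝ) : ℂ)))‖ =
          ‖F p‖ * gaussWindow d (y - p.1) := fun p y => by
        rw [norm_mul, norm_window_mul_cexp]
      refine ⟨Filter.Eventually.of_forall fun p => ?_, ?_⟩
      · have hc : Continuous fun y => F p * ((gaussWindow d (y - p.1) : ℂ) *
            Complex.exp (Complex.I * ((inner ℝ y p.2 : ℝ) : ℂ))) := by fun_prop
        refine (((gaussWindow_integrable d).comp_sub_right p.1).const_mul ‖F p‖).mono'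
          hc.aestronglyMeasurable
          (Filter.Eventually.of_forall fun y => (h1 p y).le)
      · simp only [h1, integral_const_mul, integral_sub_right_eq_self (gaussWindow d)]
        exact hF.norm.mul_const _
    · exact hF.aestronglyMeasurable.comp_fst.mul
        (Continuous.aestronglyMeasurable (by fun_prop))
  exact h0.mul_bdd (c := M) (hg.comp continuous_snd).aestronglyMeasurable
    (Filter.Eventually.of_forall fun q => hM q.2)

theorem integral_stftAdjointFun_mul (hF : Integrable F) {g : EuclideanSpace ℝ (Fin d) → ℂ}
    (hg : Continuous g) {M : ℝ} (hM : ∀ y, ‖g y‖ ≤ M) :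
    ∫ y, stftAdjointFun F y * g y = ∫ p, F p * ∫ y, g y * (gaussWindow d (y - p.1) : ℂ) *
      Complex.exp (Complex.I * ((inner ℝ y p.2 : ℝ) : ℂ)) := by
  have h := integral_integral_swap (f := fun p y => F p * ((gaussWindow d (y - p.1) : ℂ) *
    Complex.exp (Complex.I * ((inner ℝ y p.2 : ℝ) : ℂ))) * g y)
    (integrable_adjoint_kernel hF hg hM)
  simp only [integral_mul_const] at h
  rw [show (fun y => stftAdjointFun F y * g y) = fun y => (∫ p, F p *
    ((gaussWindow d (y - p.1) : ℂ) * Complex.exp (Complex.I * ((inner ℝ y p.2 : ℝ) : ℂ)))) * g y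
    from rfl, ← h]
  congr 1
  funext p
  rw [← integral_const_mul]
  congr 1
  funext y
  ring

/-- The function is integrable by Fubini and bounded because the window is, hence square integrable.
-/
theorem memLp_stftAdjointFun (hF : Integrable F) : MemLp (stftAdjointFun F) 2 := by
  have h := (integrable_adjoint_kernel hF (g := fun _ => 1) continuous_const (M := 1)
    (by simp)).swap.integral_prod_left
  have hi : Integrable (stftAdjointFun F) := by
    refine h.congr (Filter.Eventually.of_forall fun y => ?_)
    simp [stftAdjointFun]
  have hC : ∀ x, gaussWindow d x ≤ Real.pi ^ (-(d : ℝ) / 4) := fun x => by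
    rw [gaussWindow]
    refine mul_le_of_le_one_right (by positivity) (Real.exp_le_one_iff.2 ?_)
    have := sq_nonneg ‖x‖
    linarith
  have hb : ∀ y, ‖stftAdjointFun F y‖ ≤ (∫ p, ‖F p‖) * Real.pi ^ (-(d : ℝ) / 4) := fun y => by
    rw [← integral_mul_const]
    refine norm_integral_le_of_norm_le (hF.norm.mul_const _)
      (Filter.Eventually.of_forall fun p => ?_)
    rw [norm_mul, norm_window_mul_cexp]
    exact mul_le_mul_of_nonneg_left (hC _) (norm_nonneg _)
  rw [memLp_two_iff_integrable_sq_norm hi.aestronglyMeasurable]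
  refine (hi.norm.const_mul ((∫ p, ‖F p‖) * Real.pi ^ (-(d : ℝ) / 4))).mono' (hi.aestronglyMeasurable.norm.pow 2)
    (Filter.Eventually.of_forall fun y => ?_)
  rw [norm_pow, norm_norm, sq]
  exact mul_le_mul_of_nonneg_right (hb y) (norm_nonneg _)

theorem star_stft_star (g : EuclideanSpace ℝ (Fin d) → ℂ)
    (p : EuclideanSpace ℝ (Fin d) × EuclideanSpace ℝ (Fin d)) :
    star (stft (fun y => star (g y)) p) = ∫ y, g y * (gaussWindow d (y - p.1) : ℂ) *
      Complex.exp (Complex.I * ((inner ℝ y p.2 : ℝ) : ℂ)) := by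
  rw [stft, Complex.star_def, ← integral_conj]
  congr 1
  funext y
  simp [← Complex.exp_conj]

theorem stftAdjoint_eq_toTemperedDistribution (hF : Integrable F) :
    stftAdjoint F =
      Lp.toTemperedDistribution ((memLp_stftAdjointFun hF).toLp (stftAdjointFun F)) := by
  ext g
  rw [stftAdjoint_apply hF, Lp.toTemperedDistribution_apply]
  simp only [star_stft_star]
  rw [← integral_stftAdjointFun_mul hF g.continuous
    (fun y => SchwartzMap.norm_le_seminorm ℂ g y)]
  refine integral_congr_ae ?_
  filter_upwards [(memLp_stftAdjointFun hF).coeFn_toLp] with y hy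
  rw [hy, smul_eq_mul, mul_comm]

/-- Fubini, allowed because `h_α` is bounded and continuous, reduces this to the explicit transform
of `h_α`. -/
theorem hermiteCoeff_stftAdjointFun (hF : Integrable F) (α : Fin d → ℕ) :
    hermiteCoeff (stftAdjointFun F) α = hermiteNorm α * ∫ p, F p * (mono α (complexPoint p) *
      Complex.exp (-(‖p.1‖ : ℂ) ^ 2 / 2 + sumSq (complexPoint p) / 4)) := by
  obtain ⟨C, hC⟩ := abs_hermiteRaw_le α
  have hM : ∃ M, ∀ y, ‖(hermiteFun α y : ℂ)‖ ≤ M := by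
    refine ⟨|Real.pi ^ (-(d : ℝ) / 4) * (-1) ^ (∑ j, α j) * hermiteNorm α| * |C|, fun y => ?_⟩
    rw [Complex.norm_real, hermiteFun_eq, norm_mul, Real.norm_eq_abs, Real.norm_eq_abs]
    refine mul_le_mul_of_nonneg_left ((hC y).trans ((le_abs_self _).trans ?_)) (abs_nonneg _)
    rw [abs_mul, Real.abs_exp]
    refine mul_le_of_le_one_right (abs_nonneg _) (Real.exp_le_one_iff.2 ?_)
    have := sq_nonneg ‖y‖
    linarith
  obtain ⟨M, hM⟩ := hM
  rw [hermiteCoeff, integral_stftAdjointFun_mul hF (g := fun y => (hermiteFun α y : ℂ))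
    (Complex.continuous_ofReal.comp (continuous_hermiteFun α)) hM, ← integral_const_mul]
  congr 1
  funext p
  rw [integral_hermiteFun_mul_window, mono, sumSq]
  ring

end Adjoint

/-! ### The measure attached to a radial weight -/

theorem measurePreserving_complexPoint (d : ℕ) :
    MeasurePreserving (complexPoint (d := d)) ∧ MeasurableEmbedding (complexPoint (d := d)) := by
  have h1 : MeasurePreserving
      (MeasurableEquiv.prodCongr (MeasurableEquiv.toLp 2 (Fin d → ℝ)).symm
        (MeasurableEquiv.toLp 2 (Fin d → ℝ)).symm) :=
    (PiLp.volume_preserving_ofLp (Fin d)).prod (PiLp.volume_preserving_ofLp (Fin d))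
  have h2 := (volume_measurePreserving_arrowProdEquivProdArrow ℝ ℝ (Fin d)).symm
  have h3 : MeasurePreserving
      (MeasurableEquiv.piCongrRight fun _ : Fin d => Complex.measurableEquivRealProd.symm) :=
    volume_preserving_pi fun _ => Complex.volume_preserving_equiv_real_prod.symm
  have he : complexPoint (d := d) = ((MeasurableEquiv.prodCongr
      (MeasurableEquiv.toLp 2 (Fin d → ℝ)).symm (MeasurableEquiv.toLp 2 (Fin d → ℝ)).symm).trans
      ((MeasurableEquiv.arrowProdEquivProdArrow ℝ ℝ (Fin d)).symm.trans
      (MeasurableEquiv.piCongrRight fun _ : Fin d => Complex.measurableEquivRealProd.symm))) := by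
    funext p j
    apply Complex.ext
    · simp [complexPoint]
      rfl
    · simp [complexPoint]
      rfl
  rw [he]
  exact ⟨h3.comp (h2.comp h1), MeasurableEquiv.measurableEmbedding _⟩

theorem measurePreserving_rotation {d : ℕ} {u : Fin d → ℂ} (hu : ∀ j, ‖u j‖ = 1) :
    MeasurePreserving (fun w : Fin d → ℂ => u * w) ∧
      MeasurableEmbedding (fun w : Fin d → ℂ => u * w) := by
  constructor
  · refine volume_preserving_pi (f := fun j z => u j * z) fun j => ?_
    have h := (rotation ⟨u j, by simpa [Submonoid.unitSphere] using hu j⟩).measurePreserving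
    exact h
  · refine Continuous.measurableEmbedding (by fun_prop) fun w w' h => ?_
    funext j
    have hj : u j ≠ 0 := by
      intro h0
      simpa [h0] using hu j
    exact mul_left_cancel₀ hj (congrFun h j)

/-- The density `χ(w) e^{-|w|²/4}`. -/
def weightDensity {d : ℕ} (χ : (Fin d → ℂ) → ℝ) (w : Fin d → ℂ) : ℝ :=
  χ w * Real.exp (-(∑ j, ‖w j‖ ^ 2) / 4)

/-- The measure with density `χ(w) e^{-|w|²/4}`. -/
def weightMeasure {d : ℕ} (χ : (Fin d → ℂ) → ℝ) : Measure (Fin d → ℂ) :=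
  volume.withDensity fun w => ENNReal.ofReal (weightDensity χ w)

theorem IsRadialClass.exists_norm_le {d : ℕ} {χ : (Fin d → ℂ) → ℝ} (hχ : IsRadialClass χ) :
    ∃ T : ℝ, 0 < T ∧ ∀ᵐ w : Fin d → ℂ, T < ‖w‖ → χ w = 0 := by
  obtain ⟨t₁, t₂, ht₁, ht₂, h⟩ := hχ
  have h2 : ∀ j, 0 < t₂ j := fun j => (ht₁ j).trans_le (ht₂ j)
  have h0 : 0 ≤ ∑ j, t₂ j := Finset.sum_nonneg fun j _ => (h2 j).le
  -- The sum dominates every `t₂ j`; the added `1` keeps the radius positive when `d = 0`.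
  refine ⟨∑ j, t₂ j + 1, by positivity, ?_⟩
  filter_upwards [h.support] with w hw hT
  refine hw fun hle => hT.not_ge ?_
  rw [pi_norm_le_iff_of_nonneg (by positivity)]
  intro j
  have := Finset.single_le_sum (f := t₂) (fun i _ => (h2 i).le) (Finset.mem_univ j)
  linarith [hle j]

theorem IsRadialClass.memLp_top {d : ℕ} {χ : (Fin d → ℂ) → ℝ} (hχ : IsRadialClass χ) :
    MemLp χ ⊤ := by
  obtain ⟨t₁, t₂, -, -, h⟩ := hχ
  exact h.memLp_top

theorem IsRadialClass.nonneg {d : ℕ} {χ : (Fin d → ℂ) → ℝ} (hχ : IsRadialClass χ) :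
    ∀ᵐ w, 0 ≤ χ w := by
  obtain ⟨t₁, t₂, -, -, h⟩ := hχ
  exact h.nonneg

theorem IsRadialClass.integrable {d : ℕ} {χ : (Fin d → ℂ) → ℝ} (hχ : IsRadialClass χ) :
    Integrable χ := by
  obtain ⟨T, -, hT⟩ := hχ.exists_norm_le
  have h3 : IntegrableOn χ (Metric.closedBall 0 T) := by
    have : IsFiniteMeasure (volume.restrict (Metric.closedBall (0 : Fin d → ℂ) T)) :=
      ⟨by rw [Measure.restrict_apply_univ]; exact measure_closedBall_lt_top⟩
    exact (hχ.memLp_top.restrict _).integrable le_top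
  refine (h3.integrable_indicator measurableSet_closedBall).congr ?_
  filter_upwards [hT] with w hw
  by_cases h : w ∈ Metric.closedBall (0 : Fin d → ℂ) T
  · rw [Set.indicator_of_mem h]
  · rw [Set.indicator_of_notMem h, hw (by simpa using h)]

theorem IsRadialClass.integrable_weightDensity {d : ℕ} {χ : (Fin d → ℂ) → ℝ}
    (hχ : IsRadialClass χ) : Integrable (weightDensity χ) := by
  refine hχ.integrable.mul_bdd (c := 1) (Continuous.aestronglyMeasurable (by fun_prop))
    (Filter.Eventually.of_forall fun w => ?_)
  rw [Real.norm_eq_abs, Real.abs_exp, Real.exp_le_one_iff]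
  have : 0 ≤ ∑ j, ‖w j‖ ^ 2 := Finset.sum_nonneg fun j _ => by positivity
  linarith

theorem IsRadialClass.weightDensity_rotation {d : ℕ} {χ : (Fin d → ℂ) → ℝ}
    (hχ : IsRadialClass χ) {u : Fin d → ℂ} (hu : ∀ j, ‖u j‖ = 1) :
    ∀ᵐ w, weightDensity χ (u * w) = weightDensity χ w := by
  obtain ⟨t₁, t₂, -, -, h⟩ := hχ
  obtain ⟨χ₀, h0⟩ := h.radial
  filter_upwards [h0, (measurePreserving_rotation hu).1.quasiMeasurePreserving.ae h0] with w h1 h2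
  simp only [weightDensity, h1, h2, Pi.mul_apply, norm_mul, hu, one_mul]

theorem IsRadialClass.isReinhardtMeasure {d : ℕ} {χ : (Fin d → ℂ) → ℝ} (hχ : IsRadialClass χ) :
    IsReinhardtMeasure (weightMeasure χ) := by
  have hm : AEMeasurable (fun w => ENNReal.ofReal (weightDensity χ w)) :=
    hχ.integrable_weightDensity.aestronglyMeasurable.aemeasurable.ennreal_ofReal
  refine ⟨isFiniteMeasure_withDensity_ofReal hχ.integrable_weightDensity.2, ?_, fun u hu => ?_, ?_⟩
  · obtain ⟨T, hT0, hT⟩ := hχ.exists_norm_le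
    refine ⟨T, hT0, ?_⟩
    rw [weightMeasure, ae_withDensity_iff' hm]
    filter_upwards [hT] with w hw h
    by_contra! hlt
    exact h (by simp [weightDensity, hw hlt])
  · obtain ⟨hp, he⟩ := measurePreserving_rotation hu
    refine ⟨hp.measurable, Measure.ext fun s hs => ?_⟩
    rw [Measure.map_apply hp.measurable hs, weightMeasure,
      withDensity_apply _ (hp.measurable hs), withDensity_apply _ hs,
      ← hp.setLIntegral_comp_preimage_emb he
        (fun w => ENNReal.ofReal (weightDensity χ w)) s]
    refine lintegral_congr_ae (ae_restrict_of_ae ?_)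
    filter_upwards [hχ.weightDensity_rotation hu] with w hw
    rw [hw]
  · obtain ⟨t₁, t₂, ht₁, -, h⟩ := hχ
    obtain ⟨c, hc, hlow⟩ := h.lower
    obtain ⟨ρ, hρt, hρ⟩ : ∃ ρ : ℝ, (∀ j, ρ < t₁ j) ∧ 0 < ρ := by
      have h1 : ∀ᶠ ρ in nhdsWithin (0 : ℝ) (Set.Ioi 0), ∀ j, ρ < t₁ j :=
        Filter.eventually_all.2 fun j => nhdsWithin_le_nhds (Iio_mem_nhds (ht₁ j))
      exact (h1.and self_mem_nhdsWithin).exists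
    refine ⟨ρ, hρ, fun h0 => ?_⟩
    rw [weightMeasure, withDensity_apply_eq_zero' hm] at h0
    -- A nonempty open shell inside the polydisc where `χ ≥ c`; it has positive volume and positive
    -- density almost everywhere.
    set O : Set (Fin d → ℂ) := {w | ∀ j, ρ < ‖w j‖ ∧ ‖w j‖ < t₁ j} with hO
    have hOo : IsOpen O := by
      rw [hO, Set.ofPred_forall]
      refine isOpen_iInter_of_finite fun j => ?_
      have hc : Continuous fun w : Fin d → ℂ => ‖w j‖ := by fun_prop
      exact (isOpen_lt continuous_const hc).inter (isOpen_lt hc continuous_const)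
    have hOn : O.Nonempty := by
      refine ⟨fun j => (((ρ + t₁ j) / 2 : ℝ) : ℂ), fun j => ?_⟩
      have := hρt j
      rw [Complex.norm_real, Real.norm_of_nonneg (by linarith)]
      constructor <;> linarith
    refine (hOo.measure_pos volume hOn).ne' (measure_mono_null_ae ?_ h0)
    filter_upwards [hlow] with w hw hwO
    refine ⟨?_, fun j => (hwO j).1.le⟩
    have : 0 < weightDensity χ w :=
      mul_pos (hc.trans_le (hw fun j => (hwO j).2)) (Real.exp_pos _)
    simpa using this

theorem IsRadialClass.integral_weightMeasure {d : ℕ} {χ : (Fin d → ℂ) → ℝ} (hχ : IsRadialClass χ)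
    (g : (Fin d → ℂ) → ℂ) :
    ∫ w, g w ∂weightMeasure χ = ∫ p, (weightDensity χ (complexPoint p) : ℂ) * g (complexPoint p) := by
  have hm : AEMeasurable (fun w => ENNReal.ofReal (weightDensity χ w)) :=
    hχ.integrable_weightDensity.aestronglyMeasurable.aemeasurable.ennreal_ofReal
  obtain ⟨hp, he⟩ := measurePreserving_complexPoint d
  rw [hp.integral_comp he (fun w => (weightDensity χ w : ℂ) * g w), weightMeasure,
    integral_withDensity_eq_integral_toReal_smul₀ hm (by simp)]
  refine integral_congr_ae ?_
  filter_upwards [hχ.nonneg] with w hw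
  have h0 : 0 ≤ weightDensity χ w := mul_nonneg hw (Real.exp_pos _).le
  rw [ENNReal.toReal_ofReal h0, Complex.real_smul]

/-! ### The Gaussian exponent in complex coordinates -/

theorem star_complexPoint {d : ℕ} (p : EuclideanSpace ℝ (Fin d) × EuclideanSpace ℝ (Fin d)) :
    star (complexPoint p) = fun j => (p.1 j : ℂ) - Complex.I * (p.2 j : ℂ) := by
  funext j
  simp [complexPoint, sub_eq_add_neg]

theorem sumSq_complexPoint {d : ℕ} (p : EuclideanSpace ℝ (Fin d) × EuclideanSpace ℝ (Fin d)) :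
    sumSq (complexPoint p) =
      (‖p.1‖ : ℂ) ^ 2 - (‖p.2‖ : ℂ) ^ 2 + 2 * (Complex.I * ((inner ℝ p.1 p.2 : ℝ) : ℂ)) := by
  rw [← Complex.ofReal_pow, ← Complex.ofReal_pow, EuclideanSpace.real_norm_sq_eq,
    EuclideanSpace.real_norm_sq_eq, ← sum_ofReal_mul_ofReal, sumSq, Finset.mul_sum,
    Finset.mul_sum, Complex.ofReal_sum, Complex.ofReal_sum, ← Finset.sum_sub_distrib,
    ← Finset.sum_add_distrib]
  refine Finset.sum_congr rfl fun j _ => ?_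
  simp only [complexPoint]
  push_cast
  linear_combination ((p.2 j : ℂ)) ^ 2 * Complex.I_sq

theorem sumSq_star {d : ℕ} (w : Fin d → ℂ) : sumSq (star w) = star (sumSq w) := by
  simp [sumSq]

theorem sum_norm_sq_complexPoint {d : ℕ}
    (p : EuclideanSpace ℝ (Fin d) × EuclideanSpace ℝ (Fin d)) :
    ∑ j, ‖complexPoint p j‖ ^ 2 = ‖p.1‖ ^ 2 + ‖p.2‖ ^ 2 := by
  rw [EuclideanSpace.real_norm_sq_eq, EuclideanSpace.real_norm_sq_eq, ← Finset.sum_add_distrib]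
  refine Finset.sum_congr rfl fun j _ => ?_
  rw [← Complex.normSq_eq_norm_sq, Complex.normSq_apply]
  simp [complexPoint]
  ring

/-- The Hermite coefficients of `V_φ^* F` as Gaussian moments of an entire function. -/
theorem IsRadialClass.integral_eq_moment {d : ℕ} {χ : (Fin d → ℂ) → ℝ} (hχ : IsRadialClass χ)
    {F : EuclideanSpace ℝ (Fin d) × EuclideanSpace ℝ (Fin d) → ℂ} {F₀ : (Fin d → ℂ) → ℂ}
    (hF : ∀ᵐ p : EuclideanSpace ℝ (Fin d) × EuclideanSpace ℝ (Fin d),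
      F p = F₀ (fun j => (p.1 j : ℂ) - Complex.I * (p.2 j : ℂ)) *
        Complex.exp (-(Complex.I * ((inner ℝ p.1 p.2 : ℝ) : ℂ))) *
        (χ (fun j => (p.1 j : ℂ) + Complex.I * (p.2 j : ℂ)) : ℂ)) (α : Fin d → ℕ) :
    ∫ p, F p * (mono α (complexPoint p) *
      Complex.exp (-(‖p.1‖ : ℂ) ^ 2 / 2 + sumSq (complexPoint p) / 4)) =
    ∫ w, F₀ (star w) * Complex.exp (sumSq (star w) / 8) *
      (Complex.exp (-(1 / 8) * sumSq w) * mono α w) ∂weightMeasure χ := by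
  rw [hχ.integral_weightMeasure]
  refine integral_congr_ae ?_
  filter_upwards [hF] with p hp
  rw [hp, ← star_complexPoint, weightDensity, sum_norm_sq_complexPoint]
  change F₀ (star (complexPoint p)) * _ * (χ (complexPoint p) : ℂ) * _ = _
  have hs : sumSq (star (complexPoint p)) =
      (‖p.1‖ : ℂ) ^ 2 - (‖p.2‖ : ℂ) ^ 2 - 2 * (Complex.I * ((inner ℝ p.1 p.2 : ℝ) : ℂ)) := by
    rw [sumSq_star, sumSq_complexPoint]
    simp [sub_eq_add_neg]
  -- Both exponents equal `-(‖x‖² + ‖ξ‖²)/4 - i⟨x,ξ⟩/2`, and the last term is `(Σ w̄_j² - Σ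
  -- w_j²)/8`: an antiholomorphic and a holomorphic factor.
  have h : Complex.exp (-(Complex.I * ((inner ℝ p.1 p.2 : ℝ) : ℂ))) *
      Complex.exp (-(‖p.1‖ : ℂ) ^ 2 / 2 + sumSq (complexPoint p) / 4) =
      (Real.exp (-(‖p.1‖ ^ 2 + ‖p.2‖ ^ 2) / 4) : ℂ) *
      Complex.exp (sumSq (star (complexPoint p)) / 8) *
      Complex.exp (-(1 / 8) * sumSq (complexPoint p)) := by
    rw [Complex.ofReal_exp, ← Complex.exp_add, ← Complex.exp_add, ← Complex.exp_add, hs,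
      sumSq_complexPoint]
    congr 1
    push_cast
    ring
  rw [Complex.ofReal_mul]
  linear_combination F₀ (star (complexPoint p)) * (χ (complexPoint p) : ℂ) *
    mono α (complexPoint p) * h

/-! ### The decay condition on Hermite coefficients -/

theorem hermiteNorm_eq {d : ℕ} (α : Fin d → ℕ) :
    hermiteNorm α =
      (Real.sqrt 2)⁻¹ ^ (∑ j, α j) * (∏ j, ((α j).factorial : ℝ)) ^ (-(1 / 2 : ℝ)) := by
  rw [hermiteNorm, Real.mul_rpow (by positivity) (Finset.prod_nonneg fun _ _ => by positivity)]
  congr 1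
  rw [← Real.rpow_natCast, ← Real.rpow_mul (by norm_num), Real.sqrt_eq_rpow,
    ← Real.rpow_neg (by norm_num), ← Real.rpow_natCast, ← Real.rpow_mul (by norm_num), mul_comm]

/-- The decay condition of `H_{0,♭_1}` in terms of the rescaled coefficients. -/
theorem flat_bound_iff_superDecay {d : ℕ} (a : (Fin d → ℕ) → ℂ) :
    (∀ r : Fin d → ℝ, (∀ j, 0 < r j) →
      ∃ C : ℝ, ∀ α, ‖(hermiteNorm α : ℂ) * a α‖ ≤ C * thetaFlat 1 r α) ↔ SuperDecay a := by
  have hn : ∀ α : Fin d → ℕ, ‖(hermiteNorm α : ℂ) * a α‖ = (Real.sqrt 2)⁻¹ ^ (∑ j, α j) *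
      ‖a α‖ * (∏ j, ((α j).factorial : ℝ)) ^ (-(1 / 2 : ℝ)) := fun α => by
    rw [norm_mul, Complex.norm_real, Real.norm_of_nonneg (hermiteNorm_pos α).le, hermiteNorm_eq]
    ring
  have hp : ∀ α : Fin d → ℕ, 0 < (∏ j, ((α j).factorial : ℝ)) ^ (-(1 / 2 : ℝ)) := fun α =>
    Real.rpow_pos_of_pos (Finset.prod_pos fun j _ => Nat.cast_pos.2 (Nat.factorial_pos _)) _
  have hiff : ∀ (r : Fin d → ℝ) (C : ℝ) (α : Fin d → ℕ),
      ‖(hermiteNorm α : ℂ) * a α‖ ≤ C * thetaFlat 1 r α ↔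
        ‖a α‖ ≤ C * (∏ j, r j ^ α j) * (Real.sqrt 2) ^ (∑ j, α j) := fun r C α => by
    rw [hn, thetaFlat, mul_one 2, ← mul_assoc, mul_le_mul_iff_left₀ (hp α), inv_pow,
      inv_mul_le_iff₀ (by positivity), mul_comm]
  simp only [hiff]
  constructor
  · intro h s hs
    obtain ⟨C, hC⟩ := h (fun _ => s / Real.sqrt 2) (fun _ => by positivity)
    refine ⟨C, fun α => (hC α).trans_eq ?_⟩
    rw [Finset.prod_pow_eq_pow_sum, mul_assoc, ← mul_pow, div_mul_cancel₀ _ (by positivity)]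
  · intro h r hr
    -- A single radius below all `r j` reduces the multi-radius condition to a scalar one.
    obtain ⟨s, hsr, hs⟩ : ∃ s : ℝ, (∀ j, s < r j) ∧ 0 < s := by
      have h1 : ∀ᶠ s in nhdsWithin (0 : ℝ) (Set.Ioi 0), ∀ j, s < r j :=
        Filter.eventually_all.2 fun j => nhdsWithin_le_nhds (Iio_mem_nhds (hr j))
      exact (h1.and self_mem_nhdsWithin).exists
    obtain ⟨C, hC⟩ := h (s * Real.sqrt 2) (by positivity)
    have hC0 : 0 ≤ C := by
      have := (norm_nonneg _).trans (hC 0)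
      simpa using this
    refine ⟨C, fun α => (hC α).trans ?_⟩
    rw [mul_pow, ← mul_assoc, ← Finset.prod_pow_eq_pow_sum]
    gcongr with j
    exact (hsr j).le

/-! ### Assembling the equivalence -/

theorem IsRadialClass.isBoundedCompactlySupported {d : ℕ} {χ : (Fin d → ℂ) → ℝ}
    (hχ : IsRadialClass χ)
    {B : EuclideanSpace ℝ (Fin d) × EuclideanSpace ℝ (Fin d) → ℂ} (hB : Continuous B) :
    IsBoundedCompactlySupported fun p => B p * (χ (complexPoint p) : ℂ) := by
  obtain ⟨hp, -⟩ := measurePreserving_complexPoint d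
  have hχp : MemLp (fun p => χ (complexPoint p)) ⊤ := hχ.memLp_top.comp_measurePreserving hp
  obtain ⟨T, hT0, hT⟩ := hχ.exists_norm_le
  set K : Set (EuclideanSpace ℝ (Fin d) × EuclideanSpace ℝ (Fin d)) :=
    Metric.closedBall 0 (Real.sqrt (d * T ^ 2)) with hKdef
  have hK : IsCompact K := isCompact_closedBall _ _
  have hout : ∀ᵐ p, p ∉ K → B p * (χ (complexPoint p) : ℂ) = 0 := by
    filter_upwards [hp.quasiMeasurePreserving.ae hT] with p hχ0 hpK
    rw [hχ0, Complex.ofReal_zero, mul_zero]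
    by_contra! hle
    refine hpK ?_
    have h1 : ‖p.1‖ ^ 2 + ‖p.2‖ ^ 2 ≤ d * T ^ 2 := by
      rw [← sum_norm_sq_complexPoint]
      calc ∑ j, ‖complexPoint p j‖ ^ 2 ≤ ∑ _j : Fin d, T ^ 2 := by
            gcongr with j
            exact (norm_le_pi_norm _ j).trans hle
        _ = d * T ^ 2 := by simp
    rw [hKdef, mem_closedBall_zero_iff, Prod.norm_def]
    refine max_le (Real.le_sqrt_of_sq_le ?_) (Real.le_sqrt_of_sq_le ?_)
    · nlinarith [sq_nonneg ‖p.2‖]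
    · nlinarith [sq_nonneg ‖p.1‖]
  refine ⟨?_, K, hK, hout⟩
  obtain ⟨M, hM⟩ := hK.exists_bound_of_continuousOn hB.continuousOn
  obtain ⟨C, hC⟩ : ∃ C : ℝ, ∀ᵐ p, ‖χ (complexPoint p)‖ ≤ C := by
    have h := hχp.2
    rw [eLpNorm_exponent_top] at h
    refine ⟨(eLpNormEssSup (fun p => χ (complexPoint p)) volume).toReal, ?_⟩
    filter_upwards [ae_le_eLpNormEssSup (f := fun p => χ (complexPoint p)) (μ := volume)] with p hp
    rw [← toReal_enorm]
    exact ENNReal.toReal_mono h.ne hp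
  refine memLp_top_of_bound (hB.aestronglyMeasurable.mul
    (Complex.continuous_ofReal.comp_aestronglyMeasurable hχp.1)) (|M| * |C|) ?_
  filter_upwards [hout, hC] with p h1 h2
  by_cases hpK : p ∈ K
  · rw [norm_mul, Complex.norm_real]
    exact mul_le_mul ((hM p hpK).trans (le_abs_self _)) (h2.trans (le_abs_self _))
      (norm_nonneg _) (abs_nonneg _)
  · rw [h1 hpK, norm_zero]
    positivity

theorem hermiteCoeff_congr {d : ℕ} {u v : EuclideanSpace ℝ (Fin d) → ℂ} (h : u =ᵐ[volume] v)
    (α : Fin d → ℕ) : hermiteCoeff u α = hermiteCoeff v α := by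
  refine integral_congr_ae ?_
  filter_upwards [h] with x hx
  rw [hx]

theorem ae_eq_of_hermiteCoeff_eq {d : ℕ} {u v : EuclideanSpace ℝ (Fin d) → ℂ}
    (hu : MemLp u 2) (hv : MemLp v 2) (h : ∀ α, hermiteCoeff u α = hermiteCoeff v α) :
    u =ᵐ[volume] v := by
  have hi : ∀ {w : EuclideanSpace ℝ (Fin d) → ℂ}, MemLp w 2 → ∀ α : Fin d → ℕ,
      Integrable fun x => w x * (hermiteFun α x : ℂ) := fun hw α => by
    refine integrable_mul_of_abs_le_gauss hw (continuous_hermiteFun α) ?_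
    obtain ⟨C, hC⟩ := abs_hermiteRaw_le α
    refine ⟨|Real.pi ^ (-(d : ℝ) / 4) * (-1) ^ (∑ j, α j) * hermiteNorm α| * C, fun x => ?_⟩
    rw [hermiteFun_eq, abs_mul, mul_assoc |_| C]
    exact mul_le_mul_of_nonneg_left (hC x) (abs_nonneg _)
  have h0 := ae_eq_zero_of_hermiteCoeff (hu.sub hv) fun α => by
    have h1 := integral_sub (hi hu α) (hi hv α)
    have h2 := h α
    simp only [hermiteCoeff] at h2
    rw [h2, sub_self] at h1
    simpa only [hermiteCoeff, Pi.sub_apply, sub_mul] using h1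
  filter_upwards [h0] with x hx
  exact sub_eq_zero.1 hx

theorem mainTheorem11 (d : ℕ) (χ : (Fin d → ℂ) → ℝ) (hχ : IsRadialClass χ)
    (f : TemperedDistribution (EuclideanSpace ℝ (Fin d)) ℂ) :
    f ∈ pilipovicBeurlingFlat d 1 ↔
      ∃ F : EuclideanSpace ℝ (Fin d) × EuclideanSpace ℝ (Fin d) → ℂ,
        IsBoundedCompactlySupported F ∧
        (∃ F₀ : (Fin d → ℂ) → ℂ, Differentiable ℂ F₀ ∧
          ∀ᵐ p : EuclideanSpace ℝ (Fin d) × EuclideanSpace ℝ (Fin d),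
            F p = F₀ (fun j => (p.1 j : ℂ) - Complex.I * (p.2 j : ℂ)) *
              Complex.exp (-(Complex.I * ((inner ℝ p.1 p.2 : ℝ) : ℂ))) *
              (χ (fun j => (p.1 j : ℂ) + Complex.I * (p.2 j : ℂ)) : ℂ)) ∧
        f = stftAdjoint F := by
  have hμ := hχ.isReinhardtMeasure
  have hQ := differentiable_sumSq (d := d)
  constructor
  · rintro ⟨u, rfl, hu⟩
    set a : (Fin d → ℕ) → ℂ := fun α => hermiteCoeff u α / hermiteNorm α with ha
    have hN : ∀ α : Fin d → ℕ, (hermiteNorm α : ℂ) ≠ 0 :=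
      fun α => Complex.ofReal_ne_zero.2 (hermiteNorm_pos α).ne'
    have hc : ∀ α, hermiteCoeff u α = hermiteNorm α * a α := fun α => by
      rw [ha, mul_div_cancel₀ _ (hN α)]
    simp only [hc] at hu
    obtain ⟨G, hG, hGa⟩ := hμ.exists_entire_gaussian_moments
      ((flat_bound_iff_superDecay a).1 hu) (-(1 / 8))
    -- The exponential compensates the antiholomorphic factor `e^{Σ w̄_j²/8}` of the moment formula,
    -- so that `G` itself is left.
    set F₀ : (Fin d → ℂ) → ℂ := fun z => G z * Complex.exp (-sumSq z / 8) with hF₀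
    have hF₀d : Differentiable ℂ F₀ := by fun_prop
    have hF₀c := hF₀d.continuous
    set F : EuclideanSpace ℝ (Fin d) × EuclideanSpace ℝ (Fin d) → ℂ := fun p =>
      F₀ (fun j => (p.1 j : ℂ) - Complex.I * (p.2 j : ℂ)) *
        Complex.exp (-(Complex.I * ((inner ℝ p.1 p.2 : ℝ) : ℂ))) *
        (χ (fun j => (p.1 j : ℂ) + Complex.I * (p.2 j : ℂ)) : ℂ) with hF
    have hFb : IsBoundedCompactlySupported F := hχ.isBoundedCompactlySupported (by fun_prop)
    refine ⟨F, hFb, ⟨F₀, hF₀d, Filter.Eventually.of_forall fun p => rfl⟩, ?_⟩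
    have hFi := hFb.integrable
    rw [stftAdjoint_eq_toTemperedDistribution hFi]
    congr 1
    -- Two square integrable functions with the same Hermite coefficients coincide, so it remains to
    -- compare coefficients.
    refine Lp.ext ((ae_eq_of_hermiteCoeff_eq (Lp.memLp u) (memLp_stftAdjointFun hFi)
      fun α => ?_).trans (MemLp.coeFn_toLp _).symm)
    rw [hc, hermiteCoeff_stftAdjointFun hFi,
      hχ.integral_eq_moment (F₀ := F₀) (Filter.Eventually.of_forall fun p => rfl), ← hGa]
    congr 2
    funext w
    rw [hF₀]
    have : Complex.exp (-sumSq (star w) / 8) * Complex.exp (sumSq (star w) / 8) = 1 := by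
      rw [← Complex.exp_add, neg_div, neg_add_cancel, Complex.exp_zero]
    linear_combination -G (star w) * (Complex.exp (-(1 / 8) * sumSq w) * mono α w) * this
  · rintro ⟨F, hFb, ⟨F₀, hF₀, hF⟩, rfl⟩
    have hFi := hFb.integrable
    refine ⟨_, stftAdjoint_eq_toTemperedDistribution hFi, ?_⟩
    simp only [hermiteCoeff_congr (MemLp.coeFn_toLp (memLp_stftAdjointFun hFi)),
      hermiteCoeff_stftAdjointFun hFi, hχ.integral_eq_moment hF]
    rw [flat_bound_iff_superDecay]
    exact hμ.superDecay_moments (K := fun z => F₀ z * Complex.exp (sumSq z / 8))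
      (E := fun w => Complex.exp (-(1 / 8) * sumSq w)) (by fun_prop) (by fun_prop)

end
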